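/- Let $p(z)=a_0z^n+a_1z^{n-1}+\dots+a_n$ be a real polynomial of degree $n$ with $a_0>0$ and $a_n\neq 0$; put $a_k=0$ for $k<0$ and for $k>n$. The finite Hurwitz matrix of $p$ is $\mathcal H_n(p)=(a_{2j-i})_{i,j=1}^n$, and for integers $j\ge 0$ the Hurwitz determinants are $\Delta_j(p)=\det(a_{2l-k})_{k,l=1}^j$, with $\Delta_0(p)=1$ (so for $1\le j\le n$ they are the leading principal minors of $\mathcal H_n(p)$, and $\Delta_j(p)=0$ for $j>n$). A matrix is totally nonnegative if all its minors are nonnegative. A polynomial is stable if all its complex zeros lie in the open left half-plane. For a real polynomial $g(u)=g_0u^l+g_1u^{l-1}+\dots+g_l$ with $g_0\ne0$, put $g_k=0$ for $k<0$ and for $k>l$; one writes $g\in PF_r$ if all minors of order at most $r$ of the infinite Toeplitz matrix $\mathcal T(g)=(g_{j-i})_{i,j\ge1}$ are nonnegative. Let $m\geq 0$ be an integer. Then $\mathcal H_n(p)$ is totally nonnegative with $\Delta_m(p)\neq0$ and $\Delta_{m+1}(p)=0$ if and only if there exist real polynomials $q$ and $g$ such that $p(z)=q(z)\,g(z^2)$,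 where $q$ is stable, $\deg q=m$, and $g\in PF_{\frac{n+m}{2}}$. (For such a factorization $n-m=2\deg g$, so $\frac{n+m}{2}$ is an integer.) -/

import Mathlib

open Polynomial

namespace FiniteHurwitz

/-- All minors of order at most `r` of the (finite or infinite) real matrix `A` are nonnegative.
A minor of order `k` is given by `k` rows and `k` columns, both in increasing order. -/
def TimesNonneg {ι κ : Type*} [Preorder ι] [Preorder κ] (r : ℕ) (A : Matrix ι κ ℝ) : Prop :=
  ∀ k : ℕ, k ≤ r → ∀ (rows : Fin k → ι) (cols : Fin k → κ),
    StrictMono rows → StrictMono cols → 0 ≤ (A.submatrix rows cols).det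

/-- Totally nonnegative matrices: all minors, of every order, are nonnegative. -/
def TotallyNonneg {ι κ : Type*} [Preorder ι] [Preorder κ] (A : Matrix ι κ ℝ) : Prop :=
  ∀ r : ℕ, TimesNonneg r A

/-- The coefficient `a_k` of `p(z) = a_0 z ^ n + a_1 z ^ (n - 1) + ⋯ + a_n`, where `n = deg p`;
it is `0` for `k > n`. -/
noncomputable def descCoeff (p : ℝ[X]) (k : ℕ) : ℝ :=
  if k ≤ p.natDegree then p.coeff (p.natDegree - k) else 0

/-- The Hurwitz matrix of order `k` of `p`. With rows and columns numbered from `1`, its entry in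
row `i` and column `j` is `a_{2j-i}`, read as `0` if `2j - i` is negative or exceeds the degree.
The numbering from `0` used here turns `2j - i` into `2j + 1 - i`. -/
noncomputable def hurwitzMatrix (k : ℕ) (p : ℝ[X]) : Matrix (Fin k) (Fin k) ℝ :=
  Matrix.of fun i j =>
    if (i : ℕ) ≤ 2 * (j : ℕ) + 1 then descCoeff p (2 * (j : ℕ) + 1 - (i : ℕ)) else 0

/-- The Hurwitz determinant `Δ_j(p)`: for `j ≤ deg p` it is the leading principal minor of order
`j` of the finite Hurwitz matrix; `Δ_0(p) = 1`; for `j > deg p` the convention `a_i = 0` for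
`i > deg p` applies. -/
noncomputable def hurwitzMinor (j : ℕ) (p : ℝ[X]) : ℝ :=
  (hurwitzMatrix j p).det

/-- (Hurwitz) stable polynomials: all complex zeros lie in the open left half-plane. -/
def IsStable (q : ℝ[X]) : Prop :=
  ∀ z : ℂ, aeval z q = 0 → z.re < 0

/-- The infinite upper triangular Toeplitz matrix with entries `g_{j-i}`, for
`g(u) = g_0 u ^ l + g_1 u ^ (l - 1) + ⋯ + g_l`. -/
noncomputable def toeplitzMatrix (g : ℝ[X]) : Matrix ℕ ℕ ℝ :=
  Matrix.of fun i j => if i ≤ j then descCoeff g (j - i) else 0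

/-- The class `PF_r`: the infinite Toeplitz matrix of `g` is `r`-times nonnegative. -/
def IsPF (r : ℕ) (g : ℝ[X]) : Prop :=
  TimesNonneg r (toeplitzMatrix g)

end FiniteHurwitz

namespace FiniteHurwitz

/-! The engine is Routh reduction. A polynomial with `a_1 ≠ 0` is a lift `p = p₁ + c z E`, where `c
= a_0 / a_1` and `E` is the part of `p₁` of the parity of its degree. On infinite Hurwitz matrices,
row `i` of `p` is row `i + 1` of `p₁`, plus `c` times row `i` of `p₁` when `i` is odd (rows numbered
from 0). Minors in initial rows therefore reduce to those of `p₁`, and `Δ_{k+1}(p)` is the leading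
coefficient of `p₁` times `Δ_k(p₁)`. Lifting commutes with multiplication by `g(z²)`, and it both
preserves and reflects stability for `c > 0`; so stable polynomials of degree `m` with positive
leading coefficient are exactly the `m`-fold lifts of positive constants (`RouthChain`).

From total nonnegativity to the factorization: if `a_1 = 0`, nonnegative minors of order 1 and 2
force all odd coefficients to vanish, so `p = g(z²)` and `Δ_1 = 0`. Hence reduction runs for exactly
`m` steps, and undoing it gives `p = q g(z²)` (`exists_factorization`). The Hurwitz matrix of `p` is
that of `q` times the Toeplitz matrix of `g`. With `l = deg g`, suitable `m + l = (n + m)/2` rows of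
the first factor live on the first `m + l` columns and have positive determinant there, so the
Toeplitz minors of that order in initial rows are nonnegative (`RouthChain.isPF`). All other minors
of order at most `m + l` follow from Fekete's criterion, after a perturbation by `(1 + εu)^M` that
makes the relevant minors positive (`timesNonneg_seqToeplitz`).

Conversely, for `g(z²)` the nonzero rows of the Hurwitz matrix are Toeplitz rows of `g`, and each
lift expresses minors as nonnegative combinations of minors reaching one row further down
(`RouthChain.minor_nonneg`). -/

/-! ### Determinants with bidiagonal rows -/

/-- Expansion of a determinant whose rows are of the form `x (i + 1) + c i • x i`. -/
theorem det_bidiagonal_rows {k : ℕ} (x : ℕ → Fin k → ℝ) (c : ℕ → ℝ) (I : Fin k → ℕ) :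
    (Matrix.of fun s => x (I s + 1) + c (I s) • x (I s)).det =
      ∑ S : Finset (Fin k), (∏ s ∈ S, c (I s)) *
        (Matrix.of fun s => x (if s ∈ S then I s else I s + 1)).det := by
  have h := (Matrix.detRowAlternating (n := Fin k) (R := ℝ)).map_add_univ
    (fun s => c (I s) • x (I s)) (fun s => x (I s + 1))
  have e : (Matrix.of fun s => x (I s + 1) + c (I s) • x (I s)).det =
      Matrix.detRowAlternating ((fun s => c (I s) • x (I s)) + fun s => x (I s + 1)) := by
    rw [add_comm]; rfl
  rw [e, h]
  refine Finset.sum_congr rfl fun S _ => ?_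
  have h2 := (Matrix.detRowAlternating (n := Fin k) (R := ℝ)).map_piecewise_smul
    (fun s => c (I s)) (fun s => x (if s ∈ S then I s else I s + 1)) S
  have e2 : (S.piecewise (fun s => c (I s) • x (I s)) fun s => x (I s + 1)) =
      S.piecewise (fun s => c (I s) • x (if s ∈ S then I s else I s + 1))
        (fun s => x (if s ∈ S then I s else I s + 1)) := by
    funext s
    by_cases hs : s ∈ S <;> simp [hs]
  rw [e2]
  exact h2

theorem monotone_lower {k : ℕ} {I : Fin k → ℕ} (hI : StrictMono I) (S : Finset (Fin k)) :
    Monotone fun s => if s ∈ S then I s else I s + 1 := by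
  intro a b hab
  rcases hab.eq_or_lt with rfl | h
  · rfl
  · have := hI h
    dsimp only
    split_ifs <;> omega

/-- Lowering some entries of `I + 1` by one leaves a weakly increasing tuple: either it is strictly
increasing and `hx` applies, or two rows coincide and the determinant is zero. -/
theorem det_lower_nonneg {k : ℕ} (x : ℕ → Fin k → ℝ) {I : Fin k → ℕ} (hI : StrictMono I)
    (hx : ∀ I' : Fin k → ℕ, StrictMono I' → (∀ s, I' s ≤ I s + 1) →
      0 ≤ (Matrix.of fun s => x (I' s)).det) (S : Finset (Fin k)) :
    0 ≤ (Matrix.of fun s => x (if s ∈ S then I s else I s + 1)).det := by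
  by_cases hinj : Function.Injective fun s => if s ∈ S then I s else I s + 1
  · refine hx _ ((monotone_lower hI S).strictMono_of_injective hinj) fun s => ?_
    split_ifs <;> omega
  · simp only [Function.Injective, not_forall] at hinj
    obtain ⟨a, b, hab, hne⟩ := hinj
    refine (Matrix.det_zero_of_row_eq hne ?_).ge
    exact congrArg x hab

theorem det_bidiagonal_rows_nonneg {k : ℕ} (x : ℕ → Fin k → ℝ) {c : ℕ → ℝ} (hc : ∀ i, 0 ≤ c i)
    {I : Fin k → ℕ} (hI : StrictMono I)
    (hx : ∀ I' : Fin k → ℕ, StrictMono I' → (∀ s, I' s ≤ I s + 1) →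
      0 ≤ (Matrix.of fun s => x (I' s)).det) :
    0 ≤ (Matrix.of fun s => x (I s + 1) + c (I s) • x (I s)).det := by
  rw [det_bidiagonal_rows]
  exact Finset.sum_nonneg fun S _ =>
    mul_nonneg (Finset.prod_nonneg fun _ _ => hc _) (det_lower_nonneg x hI hx S)

theorem det_bidiagonal_rows_pos {k : ℕ} (x : ℕ → Fin k → ℝ) {c : ℕ → ℝ} (hc : ∀ i, 0 < c i)
    {I : Fin k → ℕ} (hI : StrictMono I)
    (hx : ∀ I' : Fin k → ℕ, StrictMono I' → (∀ s, I' s ≤ I s + 1) →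
      0 ≤ (Matrix.of fun s => x (I' s)).det) (S : Finset (Fin k))
    (hS : 0 < (Matrix.of fun s => x (if s ∈ S then I s else I s + 1)).det) :
    0 < (Matrix.of fun s => x (I s + 1) + c (I s) • x (I s)).det := by
  rw [det_bidiagonal_rows]
  exact Finset.sum_pos' (fun S _ =>
    mul_nonneg (Finset.prod_nonneg fun _ _ => (hc _).le) (det_lower_nonneg x hI hx S))
    ⟨S, Finset.mem_univ _, mul_pos (Finset.prod_pos fun _ _ => hc _) hS⟩

/-- A minor of an upper triangular matrix vanishes when some column index lies left of the
row index in the same position. -/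
theorem det_submatrix_eq_zero_of_lt {k : ℕ} {A : Matrix ℕ ℕ ℝ} (hA : ∀ i j, j < i → A i j = 0)
    {I J : Fin k → ℕ} (hI : StrictMono I) (hJ : StrictMono J) {t : Fin k} (ht : J t < I t) :
    (A.submatrix I J).det = 0 := by
  -- Rows from `t` on vanish in the columns up to `t`, so the matrix is block triangular and its
  -- lower diagonal block has a zero column.
  rw [Matrix.twoBlockTriangular_det _ (fun i => i < t)]
  · refine mul_eq_zero_of_right _
      (Matrix.det_eq_zero_of_column_eq_zero ⟨t, lt_irrefl t⟩ fun i => hA _ _ ?_)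
    exact ht.trans_le (hI.monotone (not_lt.1 i.2))
  · intro i hi j hj
    exact hA _ _ ((hJ hj).trans (ht.trans_le (hI.monotone (not_lt.1 hi))))

/-! ### Plücker relation and three-term identity for minors -/

/-- The determinant as a function of its first two rows. -/
noncomputable def pairDet {k : ℕ} (N : Fin k → Fin (k + 2) → ℝ) (u v : Fin (k + 2) → ℝ) : ℝ :=
  Matrix.detRowAlternating (Matrix.vecCons u (Matrix.vecCons v N))

theorem pairDet_swap {k : ℕ} (N : Fin k → Fin (k + 2) → ℝ) (u v : Fin (k + 2) → ℝ) :
    pairDet N v u = -pairDet N u v := by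
  have h := (Matrix.detRowAlternating (n := Fin (k + 2)) (R := ℝ)).map_swap
    (Matrix.vecCons u (Matrix.vecCons v N)) (zero_ne_one (α := Fin (k + 2)))
  rw [pairDet, pairDet, ← h]
  congr 1
  funext i
  refine Fin.cases ?_ (fun i => ?_) i
  · simp
  · refine Fin.cases ?_ (fun i => ?_) i
    · simp
    · rw [Function.comp_apply, Equiv.swap_apply_of_ne_of_ne (by simp [Fin.ext_iff]) (by
        simp [Fin.ext_iff])]
      simp

/-- Three-term Plücker relation. -/
theorem pairDet_plucker {k : ℕ} (N : Fin k → Fin (k + 2) → ℝ) (a b c d : Fin (k + 2) → ℝ) :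
    pairDet N a b * pairDet N c d - pairDet N a c * pairDet N b d +
      pairDet N b c * pairDet N a d = 0 := by
  set B : Matrix (Fin (k + 2)) (Fin (k + 2)) ℝ :=
    Matrix.of (Matrix.vecCons b (Matrix.vecCons c N)) with hB
  have hdet : B.det = pairDet N b c := rfl
  have hcr := Matrix.mulVec_cramer B.transpose a
  have key : ∑ i, B.transpose.cramer a i • B i = B.det • a := by
    rw [Matrix.det_transpose] at hcr
    rw [← hcr, Matrix.mulVec_eq_sum]
    simp
  have h0 : B.transpose.cramer a 0 = pairDet N a c := by
    rw [Matrix.cramer_transpose_apply, pairDet]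
    change Matrix.detRowAlternating (B.updateRow 0 a) = _
    congr 1
    funext i
    refine Fin.cases ?_ (fun i => ?_) i
    · simp
    · rw [Matrix.updateRow_ne (Fin.succ_ne_zero i)]
      rfl
  have h1 : B.transpose.cramer a 1 = -pairDet N a b := by
    rw [Matrix.cramer_transpose_apply, ← pairDet_swap, pairDet]
    change Matrix.detRowAlternating (B.updateRow 1 a) = _
    congr 1
    funext i
    refine Fin.cases ?_ (fun i => Fin.cases ?_ (fun i => ?_) i) i
    · rw [Matrix.updateRow_ne (by simp)]
      rfl
    · simp
    · rw [Matrix.updateRow_ne (by simp [Fin.ext_iff])]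
      rfl
  -- By Cramer's rule `det B • a` is a combination of the rows `b`, `c`, `N i`. The functional `u ↦
  -- det (u, d, N)` kills every `N i`, leaving exactly the three terms.
  let ℓ : (Fin (k + 2) → ℝ) →ₗ[ℝ] ℝ :=
    { toFun := fun u => (Matrix.detRowAlternating (n := Fin (k + 2)) (R := ℝ)).curryLeft u
        (Matrix.vecCons d N)
      map_add' := fun u v => by simp
      map_smul' := fun r u => by simp }
  have h := congrArg ℓ key
  simp only [map_sum, map_smul, smul_eq_mul] at h
  rw [Fin.sum_univ_succ, Fin.sum_univ_succ, Finset.sum_eq_zero] at h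
  · rw [h0, hdet] at h
    rw [Fin.succ_zero_eq_one, h1] at h
    change pairDet N a c * pairDet N b d + (-pairDet N a b * pairDet N c d + 0) =
      pairDet N b c * pairDet N a d at h
    linarith
  · intro i _
    exact mul_eq_zero_of_right _ ((Matrix.detRowAlternating (n := Fin (k + 2))
      (R := ℝ)).map_eq_zero_of_eq (Matrix.vecCons (N i) (Matrix.vecCons d N))
      (i := 0) (j := i.succ.succ) rfl (Fin.succ_ne_zero _).symm)

theorem pairDet_single {k : ℕ} (N : Fin k → Fin (k + 2) → ℝ) (a : Fin (k + 2))
    (v : Fin (k + 2) → ℝ) :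
    pairDet N (Pi.single a 1) v =
      (-1) ^ (a : ℕ) * (Matrix.of fun i j => Matrix.vecCons v N i (a.succAbove j)).det := by
  change Matrix.det (Matrix.of (Matrix.vecCons (Pi.single a 1) (Matrix.vecCons v N))) = _
  rw [Matrix.det_succ_row_zero, Finset.sum_eq_single a]
  · simp only [Matrix.of_apply, Matrix.cons_val_zero, Pi.single_eq_same, mul_one]
    rfl
  · intro b _ hb
    simp [hb]
  · simp

theorem det_vecCons_single {k : ℕ} (N : Fin k → Fin (k + 2) → ℝ) (a : Fin (k + 2))
    (b : Fin (k + 1)) :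
    (Matrix.of fun i j => Matrix.vecCons (Pi.single (a.succAbove b) (1 : ℝ)) N i
      (a.succAbove j)).det =
      (-1) ^ (b : ℕ) * (Matrix.of fun i j => N i (a.succAbove (b.succAbove j))).det := by
  rw [Matrix.det_succ_row_zero, Finset.sum_eq_single b]
  · simp
    rfl
  · intro c _ hc
    simp [hc]
  · simp

/-- Three-term relation between the minors of a matrix obtained by omitting rows of `L`. -/
theorem minor_three_term {K : ℕ} (A : Matrix ℕ ℕ ℝ) (L : Fin (K + 2) → ℕ) (J : Fin (K + 1) → ℕ)
    (s : Fin K) :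
    (A.submatrix (L ∘ s.castSucc.succ.succAbove) J).det *
        (A.submatrix (L ∘ Fin.succ ∘ Fin.castSucc) (J ∘ Fin.succ)).det =
      (A.submatrix (L ∘ Fin.castSucc) J).det *
        (A.submatrix (L ∘ s.castSucc.succ.succAbove ∘ Fin.succ) (J ∘ Fin.succ)).det +
      (A.submatrix (L ∘ Fin.succ) J).det *
        (A.submatrix (L ∘ s.castSucc.succ.succAbove ∘ Fin.castSucc) (J ∘ Fin.succ)).det := by
  set N : Fin K → Fin (K + 2) → ℝ := fun j i => A (L i) (J j.succ) with hN
  set d : Fin (K + 2) → ℝ := fun i => A (L i) (J 0) with hd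
  set t : Fin (K + 2) := s.castSucc.succ with ht
  have hF : ∀ a : Fin (K + 2), pairDet N (Pi.single a 1) d =
      (-1) ^ (a : ℕ) * (A.submatrix (L ∘ a.succAbove) J).det := by
    intro a
    rw [pairDet_single, ← Matrix.det_transpose (A.submatrix _ _)]
    congr 2
    ext i j
    refine Fin.cases ?_ (fun i => ?_) i <;> simp [hN, hd]
  have hG : ∀ (a : Fin (K + 2)) (b : Fin (K + 1)),
      pairDet N (Pi.single a 1) (Pi.single (a.succAbove b) 1) = (-1) ^ (a : ℕ) * ((-1) ^ (b : ℕ) *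
        (A.submatrix (L ∘ a.succAbove ∘ b.succAbove) (J ∘ Fin.succ)).det) := by
    intro a b
    rw [pairDet_single, det_vecCons_single, ← Matrix.det_transpose (A.submatrix _ _)]
    rfl
  have h := pairDet_plucker N (Pi.single 0 1) (Pi.single t 1) (Pi.single (Fin.last _) 1) d
  have e1 : t = (0 : Fin (K + 2)).succAbove s.castSucc := by simp [ht]
  have e2 : Fin.last (K + 1) = (0 : Fin (K + 2)).succAbove (Fin.last K) := by simp
  have e3 : Fin.last (K + 1) = t.succAbove (Fin.last K) := by
    rw [Fin.succAbove_of_lt_succ _ _ (by simp [ht, Fin.lt_def])]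
    rfl
  have h0t := hG 0 s.castSucc
  rw [← e1] at h0t
  have h0l := hG 0 (Fin.last K)
  rw [← e2] at h0l
  -- With unit vectors at `0`, `t` and the last position, the Plücker relation becomes one between
  -- minors with those rows omitted; `d` is the column that the order-`K` minors lack.
  have htl := hG t (Fin.last K)
  rw [← e3] at htl
  rw [h0t, h0l, htl, hF, hF, hF] at h
  have e4 : L ∘ (0 : Fin (K + 2)).succAbove ∘ s.castSucc.succAbove = L ∘ t.succAbove ∘ Fin.succ := by
    funext j
    simp [ht]
  have e5 : (Fin.last (K + 1)).succAbove = Fin.castSucc := by funext j; simp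
  have e6 : (Fin.last K).succAbove = Fin.castSucc := by funext j; simp
  have e7 : (0 : Fin (K + 2)).succAbove = Fin.succ := by funext j; simp
  rw [e4, e5, e6, e7] at h
  have hs : ((t : Fin (K + 2)) : ℕ) = s + 1 := rfl
  have hc : ((-1 : ℝ) ^ (s : ℕ) * (-1) ^ K) * ((-1 : ℝ) ^ (s : ℕ) * (-1) ^ K) = 1 := by
    rw [← pow_add, ← mul_pow]; simp
  simp only [hs, Fin.val_zero, Fin.val_castSucc, Fin.val_last, pow_succ, pow_zero] at h
  linear_combination ((-1 : ℝ) ^ (s : ℕ) * (-1) ^ K) * h + (-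
    (A.submatrix (L ∘ t.succAbove) J).det *
        (A.submatrix (L ∘ Fin.succ ∘ Fin.castSucc) (J ∘ Fin.succ)).det +
      (A.submatrix (L ∘ Fin.castSucc) J).det *
        (A.submatrix (L ∘ t.succAbove ∘ Fin.succ) (J ∘ Fin.succ)).det +
      (A.submatrix (L ∘ Fin.succ) J).det *
        (A.submatrix (L ∘ t.succAbove ∘ Fin.castSucc) (J ∘ Fin.succ)).det) * hc

/-! ### Fekete's criterion -/

/-- Fekete's criterion for upper triangular matrices: positivity of the minors with consecutive
rows carries over to all minors that are not zero for trivial reasons. -/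
theorem minor_pos_of_consecutive {A : Matrix ℕ ℕ ℝ} (hA : ∀ i j, j < i → A i j = 0) {r N : ℕ}
    (hcons : ∀ k ≤ r, ∀ (a : ℕ) (J : Fin k → ℕ), StrictMono J → (∀ i, a ≤ J i ∧ J i < N) →
      0 < (A.submatrix (fun i : Fin k => a + (i : ℕ)) J).det) :
    ∀ k ≤ r, ∀ I J : Fin k → ℕ, StrictMono I → StrictMono J → (∀ i, I i ≤ J i ∧ J i < N) →
      0 < (A.submatrix I J).det := by
  intro k
  induction k with
  | zero => intro _ I J _ _ _; simp
  | succ K ih =>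
    intro hK I J hI hJ
    generalize hd : I (Fin.last K) - I 0 = d
    induction d using Nat.strong_induction_on generalizing I with
    | _ d ihd =>
    intro hIJ
    by_cases hgap : ∃ s : Fin K, I s.castSucc + 1 < I s.succ
    · obtain ⟨s, hs⟩ := hgap
      -- Insert one row index in the gap. Dropping the first or the last of the enlarged tuple `L`
      -- shrinks the spread `d`, so the induction on `d` handles those minors of order `K + 1`; the
      -- minors of order `K` come from the induction on the order.
      set t : Fin (K + 2) := s.castSucc.succ with ht
      set L : Fin (K + 2) → ℕ := Fin.insertNth (α := fun _ => ℕ) t (I s.castSucc + 1) I with hL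
      have hLm : StrictMono L := Fin.strictMono_insertNth hI s _ (Nat.lt_succ_self _) hs
      have hLI : L ∘ t.succAbove = I := by funext j; simp [hL]
      have hLI' : ∀ j, L (t.succAbove j) = I j := fun j => congrFun hLI j
      have hlo : ∀ j : Fin (K + 1), L j.castSucc ≤ I j := fun j => by
        rw [← hLI' j]
        refine hLm.monotone ?_
        unfold Fin.succAbove
        split_ifs
        · exact le_rfl
        · exact Fin.castSucc_le_succ j
      have hL0 : L 0 = I 0 := by
        rw [← hLI' 0, Fin.succAbove_ne_zero_zero]
        simp [ht]
      have hLl : L (Fin.last _) = I (Fin.last _) := by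
        rw [← hLI' (Fin.last _), Fin.succAbove_of_lt_succ _ _ (by simp [ht, Fin.lt_def])]
        rfl
      have hI0l : I 0 ≤ I (Fin.last K) := hI.monotone (Fin.zero_le _)
      have nonneg_of : ∀ {k : ℕ} {I' J' : Fin k → ℕ}, StrictMono I' → StrictMono J' →
          ((∀ i, I' i ≤ J' i) → 0 < (A.submatrix I' J').det) → 0 ≤ (A.submatrix I' J').det := by
        intro k I' J' hI' hJ' h
        by_cases hle : ∀ i, I' i ≤ J' i
        · exact (h hle).le
        · push Not at hle
          obtain ⟨i, hi⟩ := hle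
          exact (det_submatrix_eq_zero_of_lt hA hI' hJ' hi).ge
      have hJs : StrictMono (J ∘ Fin.succ) := hJ.comp Fin.strictMono_succ
      have h3 := minor_three_term A L J s
      have hc : ∀ f : Fin K → Fin (K + 1), L ∘ t.succAbove ∘ f = I ∘ f := fun f => by
        rw [← Function.comp_assoc, hLI]
      rw [← ht, hLI, hc, hc] at h3
      have p1 : 0 < (A.submatrix (L ∘ Fin.succ ∘ Fin.castSucc) (J ∘ Fin.succ)).det := by
        refine ih (by omega) _ _ (hLm.comp (Fin.strictMono_succ.comp Fin.strictMono_castSucc)) hJs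
          fun i => ⟨?_, (hIJ _).2⟩
        exact (hlo i.succ).trans (hIJ _).1
      have p2 : 0 < (A.submatrix (I ∘ Fin.succ) (J ∘ Fin.succ)).det :=
        ih (by omega) _ _ (hI.comp Fin.strictMono_succ) hJs fun i => hIJ _
      have p3 : 0 ≤ (A.submatrix (I ∘ Fin.castSucc) (J ∘ Fin.succ)).det :=
        nonneg_of (hI.comp Fin.strictMono_castSucc) hJs fun h =>
          ih (by omega) _ _ (hI.comp Fin.strictMono_castSucc) hJs fun i => ⟨h i, (hIJ _).2⟩
      have p4 : 0 < (A.submatrix (L ∘ Fin.castSucc) J).det := by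
        refine ihd _ ?_ _ (hLm.comp Fin.strictMono_castSucc) rfl fun i =>
          ⟨(hlo i).trans (hIJ i).1, (hIJ i).2⟩
        have : L (Fin.last K).castSucc < L (Fin.last _) := hLm (Fin.castSucc_lt_last _)
        have h0 : L (Fin.castSucc 0) = I 0 := hL0
        have : L 0 ≤ L (Fin.last K).castSucc := hLm.monotone (Fin.zero_le _)
        simp only [Function.comp_apply]
        omega
      have p5 : 0 ≤ (A.submatrix (L ∘ Fin.succ) J).det := by
        refine nonneg_of (hLm.comp Fin.strictMono_succ) hJ fun h =>
          ihd _ ?_ _ (hLm.comp Fin.strictMono_succ) rfl fun i => ⟨h i, (hIJ i).2⟩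
        have h0 : L 0 < L (Fin.succ 0) := hLm (Fin.succ_pos _)
        have h1 : L (Fin.last K).succ = I (Fin.last K) := hLl
        have : L (Fin.succ 0) ≤ L (Fin.last K).succ := hLm.monotone (Fin.succ_le_succ_iff.2 (Fin.zero_le _))
        simp only [Function.comp_apply]
        omega
      have : 0 < (A.submatrix I J).det *
          (A.submatrix (L ∘ Fin.succ ∘ Fin.castSucc) (J ∘ Fin.succ)).det := by
        rw [h3]
        exact add_pos_of_pos_of_nonneg (mul_pos p4 p2) (mul_nonneg p5 p3)
      exact pos_of_mul_pos_left this p1.le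
    · push Not at hgap
      have hI' : I = fun i : Fin (K + 1) => I 0 + (i : ℕ) := by
        funext i
        induction i using Fin.induction with
        | zero => simp
        | succ i hi =>
          have h1 := hgap i
          have h2 := hI (Fin.castSucc_lt_succ (i := i))
          simp only [Fin.val_castSucc, Fin.val_succ] at hi ⊢
          omega
      rw [hI']
      refine hcons _ hK _ _ hJ fun i => ⟨?_, (hIJ i).2⟩
      exact (hI.monotone (Fin.zero_le i)).trans (hIJ i).1

/-! ### Toeplitz matrices: minors in initial rows control all minors -/

/-- The infinite upper triangular Toeplitz matrix of a sequence. -/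
def seqToeplitz (a : ℕ → ℝ) : Matrix ℕ ℕ ℝ :=
  Matrix.of fun i j => if i ≤ j then a (j - i) else 0

theorem toeplitzMatrix_eq (g : ℝ[X]) : toeplitzMatrix g = seqToeplitz (descCoeff g) := rfl

theorem seqToeplitz_of_le (a : ℕ → ℝ) {i j : ℕ} (h : i ≤ j) : seqToeplitz a i j = a (j - i) := by
  simp [seqToeplitz, h]

theorem seqToeplitz_of_lt (a : ℕ → ℝ) {i j : ℕ} (h : j < i) : seqToeplitz a i j = 0 := by
  simp [seqToeplitz, h]

theorem seqToeplitz_add (a : ℕ → ℝ) (s i j : ℕ) :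
    seqToeplitz a (s + i) (s + j) = seqToeplitz a i j := by
  simp only [seqToeplitz, Matrix.of_apply, Nat.add_le_add_iff_left, Nat.add_sub_add_left]

/-- The coefficient sequence of the product with `1 + ε u`. -/
def mulOneAdd (ε : ℝ) (a : ℕ → ℝ) : ℕ → ℝ
  | 0 => a 0
  | k + 1 => a (k + 1) + ε * a k

/-- The columns of a Toeplitz matrix, preceded by a zero column. -/
def toeplitzCol (a : ℕ → ℝ) (k : ℕ) : ℕ → Fin k → ℝ
  | 0 => 0
  | j + 1 => fun i => seqToeplitz a i j

theorem det_toeplitzCol (a : ℕ → ℝ) {k : ℕ} (J : Fin k → ℕ) :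
    (Matrix.of fun s => toeplitzCol a k (J s + 1)).det =
      ((seqToeplitz a).submatrix Fin.val J).det := by
  rw [← Matrix.det_transpose]
  rfl

theorem toeplitzCol_mulOneAdd (ε : ℝ) (a : ℕ → ℝ) (k j : ℕ) :
    toeplitzCol (mulOneAdd ε a) k (j + 1) = toeplitzCol a k (j + 1) + ε • toeplitzCol a k j := by
  funext i
  rcases lt_trichotomy j i with h | h | h
  · cases j with
    | zero => simp [toeplitzCol, seqToeplitz_of_lt _ h]
    | succ j =>
      simp [toeplitzCol, seqToeplitz_of_lt _ h, seqToeplitz_of_lt _ (j.lt_succ_self.trans h)]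
  · cases j with
    | zero => simp [toeplitzCol, ← h, seqToeplitz_of_le, mulOneAdd]
    | succ j =>
      have : j < i := by omega
      simp [toeplitzCol, ← h, seqToeplitz_of_le, mulOneAdd, seqToeplitz_of_lt]
  · obtain ⟨j, rfl⟩ := Nat.exists_eq_succ_of_ne_zero (Nat.ne_zero_of_lt h)
    have h' : (i : ℕ) ≤ j := Nat.lt_succ_iff.1 h
    simp [toeplitzCol, seqToeplitz_of_le _ h.le, seqToeplitz_of_le _ h', Nat.succ_sub h', mulOneAdd]

theorem det_toeplitz_initial (a : ℕ → ℝ) (k : ℕ) :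
    ((seqToeplitz a).submatrix (Fin.val : Fin k → ℕ) Fin.val).det = a 0 ^ k := by
  rw [Matrix.det_of_isUpperTriangular]
  · simp [seqToeplitz_of_le]
  · intro i j h
    exact seqToeplitz_of_lt a h

theorem toeplitzCol_nonneg {a : ℕ → ℝ} {k : ℕ}
    (ha : ∀ J : Fin k → ℕ, StrictMono J → 0 ≤ ((seqToeplitz a).submatrix Fin.val J).det)
    (J : Fin k → ℕ) (hJ : StrictMono J) : 0 ≤ (Matrix.of fun s => toeplitzCol a k (J s)).det := by
  by_cases h : ∃ s, J s = 0
  · obtain ⟨s, hs⟩ := h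
    refine (Matrix.det_eq_zero_of_row_eq_zero s fun j => ?_).ge
    simp [hs, toeplitzCol]
  · push Not at h
    have e : J = fun s => (J s - 1) + 1 := by funext s; have := h s; omega
    rw [e, det_toeplitzCol]
    refine ha _ fun s t hst => ?_
    have := hJ hst
    have := h s
    omega

theorem mulOneAdd_initial_nonneg {ε : ℝ} (hε : 0 ≤ ε) {a : ℕ → ℝ} {k : ℕ}
    (ha : ∀ J : Fin k → ℕ, StrictMono J → 0 ≤ ((seqToeplitz a).submatrix Fin.val J).det)
    (J : Fin k → ℕ) (hJ : StrictMono J) :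
    0 ≤ ((seqToeplitz (mulOneAdd ε a)).submatrix Fin.val J).det := by
  rw [← det_toeplitzCol]
  simp only [toeplitzCol_mulOneAdd]
  exact det_bidiagonal_rows_nonneg _ (c := fun _ => ε) (fun _ => hε) hJ
    fun I' hI' _ => toeplitzCol_nonneg ha I' hI'

theorem mulOneAdd_iterate_zero (ε : ℝ) (a : ℕ → ℝ) (M : ℕ) : ((mulOneAdd ε)^[M] a) 0 = a 0 := by
  induction M with
  | zero => rfl
  | succ M ih => rw [Function.iterate_succ_apply']; exact ih

theorem mulOneAdd_iterate_initial_nonneg {ε : ℝ} (hε : 0 ≤ ε) {a : ℕ → ℝ} {k : ℕ}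
    (ha : ∀ J : Fin k → ℕ, StrictMono J → 0 ≤ ((seqToeplitz a).submatrix Fin.val J).det) (M : ℕ) :
    ∀ J : Fin k → ℕ, StrictMono J →
      0 ≤ ((seqToeplitz ((mulOneAdd ε)^[M] a)).submatrix Fin.val J).det := by
  induction M with
  | zero => exact ha
  | succ M ih => rw [Function.iterate_succ_apply']; exact mulOneAdd_initial_nonneg hε ih

theorem val_le_of_strictMono {k : ℕ} {J : Fin k → ℕ} (hJ : StrictMono J) (s : Fin k) :
    (s : ℕ) ≤ J s := by
  obtain ⟨s, hs⟩ := s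
  induction s with
  | zero => simp
  | succ s ih =>
    have h1 := ih (by omega)
    have h2 : J ⟨s, by omega⟩ < J ⟨s + 1, hs⟩ := hJ (by simp [Fin.lt_def])
    simp only at h1 ⊢
    omega

/-- Each factor `1 + εu` lets one column index move left by one, so `M` factors connect `J` to the
initial minor `a 0 ^ k > 0` once the total displacement is at most `M`. -/
theorem mulOneAdd_iterate_initial_pos {ε : ℝ} (hε : 0 < ε) {a : ℕ → ℝ} (ha0 : 0 < a 0) {k : ℕ}
    (ha : ∀ J : Fin k → ℕ, StrictMono J → 0 ≤ ((seqToeplitz a).submatrix Fin.val J).det) (M : ℕ) :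
    ∀ J : Fin k → ℕ, StrictMono J → ∑ s, J s ≤ M + ∑ s : Fin k, (s : ℕ) →
      0 < ((seqToeplitz ((mulOneAdd ε)^[M] a)).submatrix Fin.val J).det := by
  have base : ∀ M, ∀ J : Fin k → ℕ, (∀ s, J s = s) →
      0 < ((seqToeplitz ((mulOneAdd ε)^[M] a)).submatrix Fin.val J).det := by
    intro M J h
    rw [show J = Fin.val from funext h, det_toeplitz_initial, mulOneAdd_iterate_zero]
    exact pow_pos ha0 k
  induction M with
  | zero =>
    intro J hJ hsum
    refine base 0 J fun s => ?_
    have h := (Finset.sum_eq_sum_iff_of_le (s := Finset.univ) (f := fun s : Fin k => (s : ℕ))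
      (g := J) (fun i _ => val_le_of_strictMono hJ i)).1
      (le_antisymm (Finset.sum_le_sum fun i _ => val_le_of_strictMono hJ i) (by simpa using hsum))
    exact (h s (Finset.mem_univ _)).symm
  | succ M ih =>
    intro J hJ hsum
    by_cases hall : ∀ s, J s = s
    · exact base _ J hall
    have hex : ∃ s : ℕ, ∃ h : s < k, J ⟨s, h⟩ ≠ s := by
      push Not at hall
      obtain ⟨s, hs⟩ := hall
      exact ⟨s, s.2, hs⟩
    classical
    obtain ⟨hsk, hs⟩ := Nat.find_spec hex
    set s := Nat.find hex with hsdef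
    have hmin : ∀ t (h : t < k), t < s → J ⟨t, h⟩ = t := by
      intro t h hts
      have := Nat.find_min hex hts
      push Not at this
      exact this h
    have hgt : s < J ⟨s, hsk⟩ := lt_of_le_of_ne (val_le_of_strictMono hJ ⟨s, hsk⟩) (Ne.symm hs)
    set σ : Fin k := ⟨s, hsk⟩ with hσ
    -- Lowering the first index that exceeds its least possible value keeps the tuple strictly
    -- increasing. The subset `{σ}` in the expansion of the determinant picks out precisely this
    -- minor.
    set J' : Fin k → ℕ := fun t => if t = σ then J t - 1 else J t with hJ'
    have hJ'm : StrictMono J' := by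
      intro t u htu
      have h1 := hJ htu
      simp only [hJ']
      split_ifs with h2 h3 h3
      · omega
      · omega
      · subst h3
        have := hmin t t.2 htu
        simp only [Fin.eta] at this
        have : (t : ℕ) < s := htu
        omega
      · exact h1
    have hsum' : ∑ t, J' t + 1 = ∑ t, J t := by
      rw [← Finset.add_sum_erase _ _ (Finset.mem_univ σ), ← Finset.add_sum_erase _ J (Finset.mem_univ σ)]
      have : ∑ t ∈ Finset.univ.erase σ, J' t = ∑ t ∈ Finset.univ.erase σ, J t :=
        Finset.sum_congr rfl fun t ht => by simp [hJ', Finset.ne_of_mem_erase ht]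
      rw [this]
      simp only [hJ', if_true]
      omega
    rw [Function.iterate_succ_apply', ← det_toeplitzCol]
    simp only [toeplitzCol_mulOneAdd]
    refine det_bidiagonal_rows_pos _ (c := fun _ => ε) (fun _ => hε) hJ
      (fun I' hI' _ => toeplitzCol_nonneg (mulOneAdd_iterate_initial_nonneg hε.le ha M) I' hI')
      {σ} ?_
    have e : (fun t => if t ∈ ({σ} : Finset (Fin k)) then J t else J t + 1) =
        fun t => J' t + 1 := by
      funext t
      simp only [Finset.mem_singleton, hJ']
      split_ifs with h
      · subst h; omega
      · rfl
    have e' : (Matrix.of fun t => toeplitzCol ((mulOneAdd ε)^[M] a) k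
        (if t ∈ ({σ} : Finset (Fin k)) then J t else J t + 1)) =
        Matrix.of fun t => toeplitzCol ((mulOneAdd ε)^[M] a) k (J' t + 1) := by
      ext t
      rw [Matrix.of_apply, Matrix.of_apply, ← congrFun e t]
    rw [e', det_toeplitzCol]
    exact ih J' hJ'm (by omega)

theorem continuous_mulOneAdd_iterate (a : ℕ → ℝ) (M : ℕ) :
    ∀ k, Continuous fun ε : ℝ => ((mulOneAdd ε)^[M] a) k := by
  induction M with
  | zero => intro k; exact continuous_const
  | succ M ih =>
    intro k
    simp only [Function.iterate_succ_apply']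
    cases k with
    | zero => exact ih 0
    | succ k => exact (ih (k + 1)).add (continuous_id.mul (ih k))

theorem mulOneAdd_zero_iterate (a : ℕ → ℝ) (M : ℕ) : (mulOneAdd 0)^[M] a = a := by
  have : mulOneAdd 0 a = a := by
    funext k
    cases k <;> simp [mulOneAdd]
  exact Function.iterate_fixed this M

/-- A Toeplitz matrix with positive diagonal is `r`-times nonnegative as soon as its minors of
order at most `r` in the initial rows are nonnegative. -/
theorem timesNonneg_seqToeplitz {a : ℕ → ℝ} (ha0 : 0 < a 0) {r : ℕ}
    (ha : ∀ k ≤ r, ∀ J : Fin k → ℕ, StrictMono J →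
      0 ≤ ((seqToeplitz a).submatrix Fin.val J).det) : TimesNonneg r (seqToeplitz a) := by
  intro k hk I J hI hJ
  by_cases hIJ : ∀ s, I s ≤ J s
  swap
  · push Not at hIJ
    obtain ⟨s, hs⟩ := hIJ
    exact (det_submatrix_eq_zero_of_lt (fun i j => seqToeplitz_of_lt a) hI hJ hs).ge
  set N := ∑ s, J s + 1 with hN
  have hJN : ∀ s, J s < N := fun s =>
    Nat.lt_succ_of_le (Finset.single_le_sum (f := J) (fun _ _ => Nat.zero_le _) (Finset.mem_univ s))
  -- There are at most `r` columns, each below `N`, so `r * N` factors cover every displacement.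
  -- Consecutive rows are moved to initial ones by translation invariance.
  have hpos : ∀ ε : ℝ, 0 < ε →
      0 < ((seqToeplitz ((mulOneAdd ε)^[r * N] a)).submatrix I J).det := by
    intro ε hε
    refine minor_pos_of_consecutive (r := r) (N := N) (fun i j => seqToeplitz_of_lt _) ?_ k hk I J
      hI hJ fun i => ⟨hIJ i, hJN i⟩
    intro k hk s J hJ hsJ
    have e : (seqToeplitz ((mulOneAdd ε)^[r * N] a)).submatrix (fun i : Fin k => s + (i : ℕ)) J =
        (seqToeplitz ((mulOneAdd ε)^[r * N] a)).submatrix Fin.val fun i => J i - s := by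
      ext i j
      have h := seqToeplitz_add ((mulOneAdd ε)^[r * N] a) s i (J j - s)
      rwa [Nat.add_sub_cancel' (hsJ j).1] at h
    rw [e]
    refine mulOneAdd_iterate_initial_pos hε ha0 (ha k hk) _ _ (fun i j hij => ?_) ?_
    · have := hJ hij
      have := (hsJ i).1
      omega
    · calc ∑ i, (J i - s) ≤ ∑ _i : Fin k, N :=
            Finset.sum_le_sum fun i _ => (Nat.sub_le _ _).trans (hsJ i).2.le
        _ = k * N := by simp
        _ ≤ r * N := Nat.mul_le_mul_right _ hk
        _ ≤ _ := Nat.le_add_right _ _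
  have hcont : Continuous fun ε : ℝ =>
      ((seqToeplitz ((mulOneAdd ε)^[r * N] a)).submatrix I J).det := by
    refine Continuous.matrix_det (continuous_matrix fun i j => ?_)
    simp only [Matrix.submatrix_apply, seqToeplitz, Matrix.of_apply]
    split_ifs
    · exact continuous_mulOneAdd_iterate a _ _
    · exact continuous_const
  have hlim := (hcont.tendsto 0).mono_left (nhdsWithin_le_nhds (s := Set.Ioi 0))
  rw [mulOneAdd_zero_iterate] at hlim
  exact ge_of_tendsto hlim (Filter.eventually_of_mem self_mem_nhdsWithin fun ε hε => (hpos ε hε).le)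

/-! ### Routh reduction on Hurwitz matrices -/

/-- The infinite Hurwitz matrix of a sequence. -/
def seqHurwitz (a : ℕ → ℝ) : Matrix ℕ ℕ ℝ :=
  Matrix.of fun i j => if i ≤ 2 * j + 1 then a (2 * j + 1 - i) else 0

theorem hurwitzMatrix_eq (k : ℕ) (p : ℝ[X]) :
    hurwitzMatrix k p = (seqHurwitz (descCoeff p)).submatrix Fin.val Fin.val := rfl

/-- The coefficient sequence of a polynomial in terms of that of its Routh reduction. -/
def routhSeq (c : ℝ) (b : ℕ → ℝ) : ℕ → ℝ
  | 0 => c * b 0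
  | j + 1 => b j + if Odd j then c * b (j + 1) else 0

theorem seqHurwitz_routhSeq (c : ℝ) (b : ℕ → ℝ) (i j : ℕ) :
    seqHurwitz (routhSeq c b) i j =
      seqHurwitz b (i + 1) j + (if Odd i then c else 0) * seqHurwitz b i j := by
  simp only [seqHurwitz, Matrix.of_apply]
  rcases lt_trichotomy i (2 * j + 1) with h | h | h
  · obtain ⟨t, ht⟩ : ∃ t, 2 * j + 1 - i = t + 1 := ⟨2 * j - i, by omega⟩
    have ht' : 2 * j + 1 - (i + 1) = t := by omega
    have hpar : Odd t ↔ Odd i := by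
      simp only [Nat.odd_iff]; omega
    rw [if_pos h.le, if_pos (show i + 1 ≤ 2 * j + 1 from h), if_pos h.le, ht, ht', routhSeq]
    by_cases hi : Odd i <;> simp [hi, hpar]
  · subst h
    simp [routhSeq]
  · have h' : ¬ i + 1 ≤ 2 * j + 1 := by omega
    simp [h.not_ge, h']

theorem seqHurwitz_add_two_add_one (b : ℕ → ℝ) (i j : ℕ) :
    seqHurwitz b (i + 2) (j + 1) = seqHurwitz b i j := by
  have h1 : i + 2 ≤ 2 * (j + 1) + 1 ↔ i ≤ 2 * j + 1 := by omega
  have h2 : 2 * (j + 1) + 1 - (i + 2) = 2 * j + 1 - i := by omega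
  simp only [seqHurwitz, Matrix.of_apply, h1, h2]

/-- Routh reduction of minors in the initial rows. -/
theorem det_seqHurwitz_routhSeq (c : ℝ) (b : ℕ → ℝ) {k : ℕ} (J : Fin k → ℕ) :
    ((seqHurwitz (routhSeq c b)).submatrix Fin.val J).det =
      ((seqHurwitz b).submatrix (fun i : Fin k => (i : ℕ) + 1) J).det := by
  cases k with
  | zero => simp
  | succ k =>
    -- For odd `i`, row `i` of `b` is row `i - 1` of the lifted matrix, so the extra term is removed
    -- by an elementary row operation.
    refine Matrix.det_eq_of_forall_row_eq_smul_add_pred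
      (fun i => if Odd ((i : ℕ) + 1) then c else 0) (fun j => ?_) fun i j => ?_
    · simp [seqHurwitz_routhSeq]
    · simp only [Matrix.submatrix_apply, seqHurwitz_routhSeq, Fin.val_succ, Fin.val_castSucc]
      by_cases hi : Odd (i : ℕ)
      · have : ¬ Odd ((i : ℕ) + 1) := by rw [Nat.odd_iff] at *; omega
        simp [this]
      · simp [hi]

/-- Below row 0 of `seqHurwitz b`, column 0 has the single nonzero candidate `b 0`, in row 1.
Expanding along it leaves rows from 2 and columns from 1, which is the original matrix again. -/
theorem det_seqHurwitz_routhSeq_cons (c : ℝ) (b : ℕ → ℝ) {k : ℕ} (J : Fin k → ℕ) :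
    ((seqHurwitz (routhSeq c b)).submatrix (Fin.val : Fin (k + 1) → ℕ)
        (Matrix.vecCons 0 fun s => J s + 1)).det =
      b 0 * ((seqHurwitz b).submatrix Fin.val J).det := by
  rw [det_seqHurwitz_routhSeq, Matrix.det_succ_column_zero, Fin.sum_univ_succ,
    Finset.sum_eq_zero]
  · have : ((seqHurwitz b).submatrix (fun i : Fin (k + 1) => (i : ℕ) + 1)
        (Matrix.vecCons 0 fun s => J s + 1)).submatrix (Fin.succAbove 0) Fin.succ =
        (seqHurwitz b).submatrix Fin.val J := by
      ext i j
      simp [seqHurwitz_add_two_add_one]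
    rw [this]
    simp [seqHurwitz]
  · intro i _
    simp [seqHurwitz]

theorem det_seqHurwitz_routhSeq_principal (c : ℝ) (b : ℕ → ℝ) (k : ℕ) :
    ((seqHurwitz (routhSeq c b)).submatrix (Fin.val : Fin (k + 1) → ℕ) Fin.val).det =
      b 0 * ((seqHurwitz b).submatrix (Fin.val : Fin k → ℕ) Fin.val).det := by
  rw [← det_seqHurwitz_routhSeq_cons c b (Fin.val : Fin k → ℕ)]
  congr 2
  funext i
  refine Fin.cases ?_ (fun i => ?_) i <;> simp

/-! ### Routh reduction on polynomials -/

theorem coeff_comp_negX (p : ℝ[X]) (i : ℕ) : (p.comp (-X)).coeff i = (-1) ^ i * p.coeff i := by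
  have h : p.comp (-X) = p.comp (C (-1) * X) := by simp
  rw [h, comp_C_mul_X_coeff, mul_comm]

/-- The sum of the terms of `p` whose degree has the same parity as `N`. -/
noncomputable def parityPart (N : ℕ) (p : ℝ[X]) : ℝ[X] :=
  C (1 / 2) * (p + C ((-1) ^ N) * p.comp (-X))

theorem coeff_parityPart (N : ℕ) (p : ℝ[X]) (i : ℕ) :
    (parityPart N p).coeff i = if Even (N + i) then p.coeff i else 0 := by
  rw [parityPart, coeff_C_mul, coeff_add, coeff_C_mul, coeff_comp_negX, ← mul_assoc, ← pow_add]
  split_ifs with h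
  · rw [h.neg_one_pow]; ring
  · rw [(Nat.not_even_iff_odd.1 h).neg_one_pow]; ring

theorem parityPart_mul_comp_sq (N l : ℕ) (q g : ℝ[X]) :
    parityPart (N + 2 * l) (q * g.comp (X ^ 2)) = parityPart N q * g.comp (X ^ 2) := by
  have h : (g.comp (X ^ 2)).comp (-X) = g.comp (X ^ 2) := by
    rw [comp_assoc]; simp
  have h2 : (-1 : ℝ) ^ (N + 2 * l) = (-1) ^ N := by simp [pow_add, pow_mul]
  rw [parityPart, parityPart, mul_comp, h, h2]
  ring

/-- The polynomial of degree `N + 1` whose Routh reduction is the polynomial `p` of degree `N`. -/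
noncomputable def routhLift (c : ℝ) (N : ℕ) (p : ℝ[X]) : ℝ[X] :=
  p + C c * X * parityPart N p

/-- An even factor does not disturb parity parts; this is what carries the factor `g(z²)` unchanged
through the reductions. -/
theorem routhLift_mul_comp_sq (c : ℝ) (N l : ℕ) (q g : ℝ[X]) :
    routhLift c (N + 2 * l) (q * g.comp (X ^ 2)) = routhLift c N q * g.comp (X ^ 2) := by
  rw [routhLift, routhLift, parityPart_mul_comp_sq]
  ring

theorem coeff_zero_routhLift (c : ℝ) (N : ℕ) (p : ℝ[X]) :
    (routhLift c N p).coeff 0 = p.coeff 0 := by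
  simp [routhLift, mul_assoc]

theorem coeff_succ_routhLift (c : ℝ) (N : ℕ) (p : ℝ[X]) (i : ℕ) :
    (routhLift c N p).coeff (i + 1) =
      p.coeff (i + 1) + c * if Even (N + i) then p.coeff i else 0 := by
  rw [routhLift, coeff_add, mul_assoc, coeff_C_mul, coeff_X_mul, coeff_parityPart]

theorem natDegree_routhLift {c : ℝ} (hc : c ≠ 0) {p : ℝ[X]} (hp : p ≠ 0) :
    (routhLift c p.natDegree p).natDegree = p.natDegree + 1 := by
  refine natDegree_eq_of_le_of_coeff_ne_zero ?_ ?_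
  · rw [natDegree_le_iff_coeff_eq_zero]
    intro i hi
    obtain ⟨i, rfl⟩ := Nat.exists_eq_succ_of_ne_zero (Nat.ne_zero_of_lt hi)
    rw [Nat.succ_eq_add_one, coeff_succ_routhLift, coeff_eq_zero_of_natDegree_lt (by omega),
      coeff_eq_zero_of_natDegree_lt (by omega)]
    simp
  · rw [coeff_succ_routhLift, coeff_eq_zero_of_natDegree_lt (by omega)]
    simp [hc, hp]

theorem leadingCoeff_routhLift {c : ℝ} (hc : c ≠ 0) {p : ℝ[X]} (hp : p ≠ 0) :
    (routhLift c p.natDegree p).leadingCoeff = c * p.leadingCoeff := by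
  rw [leadingCoeff, natDegree_routhLift hc hp, coeff_succ_routhLift,
    coeff_eq_zero_of_natDegree_lt (by omega)]
  simp

theorem descCoeff_zero (p : ℝ[X]) : descCoeff p 0 = p.leadingCoeff := by
  simp [descCoeff]

theorem descCoeff_of_le {p : ℝ[X]} {k : ℕ} (h : k ≤ p.natDegree) :
    descCoeff p k = p.coeff (p.natDegree - k) := by
  simp [descCoeff, h]

theorem descCoeff_of_gt {p : ℝ[X]} {k : ℕ} (h : p.natDegree < k) : descCoeff p k = 0 := by
  simp [descCoeff, h]

theorem descCoeff_routhLift {c : ℝ} (hc : c ≠ 0) {p : ℝ[X]} (hp : p ≠ 0) :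
    descCoeff (routhLift c p.natDegree p) = routhSeq c (descCoeff p) := by
  funext k
  cases k with
  | zero => rw [descCoeff_zero, leadingCoeff_routhLift hc hp, routhSeq, descCoeff_zero]
  | succ j =>
    have hdeg := natDegree_routhLift hc hp
    rw [routhSeq]
    rcases lt_trichotomy j p.natDegree with h | h | h
    · obtain ⟨t, ht⟩ : ∃ t, p.natDegree = j + 1 + t := ⟨p.natDegree - j - 1, by omega⟩
      have e1 : p.natDegree + 1 - (j + 1) = t + 1 := by omega
      have e2 : p.natDegree - j = t + 1 := by omega
      have e3 : p.natDegree - (j + 1) = t := by omega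
      have hpar : Even (p.natDegree + t) ↔ Odd j := by
        rw [Nat.even_iff, Nat.odd_iff]; omega
      rw [descCoeff_of_le (by omega), hdeg, e1, coeff_succ_routhLift, descCoeff_of_le h.le, e2,
        descCoeff_of_le (k := j + 1) (by omega), e3]
      simp only [hpar, mul_ite, mul_zero]
    · rw [descCoeff_of_le (by omega), hdeg, ← h, Nat.sub_self, h, coeff_zero_routhLift,
        descCoeff_of_gt (k := p.natDegree + 1) (by omega), descCoeff_of_le le_rfl, Nat.sub_self]
      simp
    · rw [descCoeff_of_gt (by omega), descCoeff_of_gt h, descCoeff_of_gt (by omega)]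
      simp

/-- Routh reduction of a polynomial whose second coefficient does not vanish. -/
theorem exists_routhLift {p : ℝ[X]} {n : ℕ} (hn : p.natDegree = n + 1) (h1 : descCoeff p 1 ≠ 0) :
    ∃ p₁ : ℝ[X], p₁.natDegree = n ∧ p₁.leadingCoeff = descCoeff p 1 ∧ p₁.coeff 0 = p.coeff 0 ∧
      p = routhLift (p.leadingCoeff / descCoeff p 1) n p₁ := by
  have ha : descCoeff p 1 = p.coeff n := by
    rw [descCoeff_of_le (by omega), hn, Nat.add_sub_cancel]
  have hlead : p.leadingCoeff = p.coeff (n + 1) := by rw [leadingCoeff, hn]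
  set c := p.leadingCoeff / descCoeff p 1 with hc
  set p₁ := p - C c * X * parityPart n p with hp₁
  -- The choice of `c` cancels the leading term. Only coefficients of the parity of `n + 1` change,
  -- so the parity part, and hence the lift, is recovered from `p₁`.
  have h0 : p₁.coeff 0 = p.coeff 0 := by simp [hp₁, mul_assoc]
  have hs : ∀ i, p₁.coeff (i + 1) = p.coeff (i + 1) - c * if Even (n + i) then p.coeff i else 0 := by
    intro i
    rw [hp₁, coeff_sub, mul_assoc, coeff_C_mul, coeff_X_mul, coeff_parityPart]
  have hpn : p₁.coeff n = p.coeff n := by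
    cases n with
    | zero => exact h0
    | succ n =>
      have : ¬ Even (n + 1 + n) := by rw [Nat.even_iff]; omega
      rw [hs, if_neg this]; simp
  have hdeg : p₁.natDegree = n := by
    refine natDegree_eq_of_le_of_coeff_ne_zero ?_ (by rwa [hpn, ← ha])
    rw [natDegree_le_iff_coeff_eq_zero]
    intro i hi
    obtain ⟨i, rfl⟩ := Nat.exists_eq_succ_of_ne_zero (Nat.ne_zero_of_lt hi)
    rw [Nat.succ_eq_add_one, hs]
    rcases (Nat.lt_succ_iff.1 hi).eq_or_lt with rfl | hi'
    · have : Even (n + n) := ⟨n, rfl⟩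
      rw [if_pos this, hc, hlead, ← ha, div_mul_cancel₀ _ h1, sub_self]
    · rw [coeff_eq_zero_of_natDegree_lt (by omega)]
      have : (if Even (n + i) then p.coeff i else 0) = 0 := by
        split_ifs with he
        · refine coeff_eq_zero_of_natDegree_lt ?_
          have : i ≠ n + 1 := by
            rintro rfl
            rw [Nat.even_iff] at he
            omega
          omega
        · rfl
      rw [this]; simp
  refine ⟨p₁, hdeg, by rw [leadingCoeff, hdeg, hpn, ha], h0, ?_⟩
  have hpar : parityPart n p₁ = parityPart n p := by
    ext i
    rw [coeff_parityPart, coeff_parityPart]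
    split_ifs with he
    · cases i with
      | zero => exact h0
      | succ i =>
        have : ¬ Even (n + i) := by rw [Nat.even_iff] at *; omega
        rw [hs, if_neg this]; simp
    · rfl
  rw [routhLift, hpar, hp₁]
  ring

/-! ### Stability under Routh reduction -/

/-- Boundary Schwarz lemma for finite Blaschke products in the right half-plane. -/
theorem blaschke_julia (R : Multiset ℂ) (hR : ∀ ρ ∈ R, ρ.re < 0) {z : ℂ} (hz : 0 ≤ z.re) :
    ‖(R.map fun ρ => z + starRingEnd ℂ ρ).prod‖ ≤ ‖(R.map fun ρ => z - ρ).prod‖ ∧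
      (R = 0 ∨ 0 < (R.map fun ρ => -ρ.re).sum) ∧
      z.re * ‖(R.map fun ρ => z - ρ).prod - (R.map fun ρ => z + starRingEnd ℂ ρ).prod‖ ^ 2 ≤
        (R.map fun ρ => -ρ.re).sum * (‖(R.map fun ρ => z - ρ).prod‖ ^ 2 -
          ‖(R.map fun ρ => z + starRingEnd ℂ ρ).prod‖ ^ 2) := by
  induction R using Multiset.induction_on with
  | empty => simp
  | cons ρ R ih =>
    have hρ : ρ.re < 0 := hR ρ (Multiset.mem_cons_self _ _)
    obtain ⟨h1, h2, h3⟩ := ih fun τ hτ => hR τ (Multiset.mem_cons_of_mem hτ)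
    simp only [Multiset.map_cons, Multiset.prod_cons, Multiset.sum_cons]
    set P := (R.map fun ρ => z - ρ).prod
    set Q := (R.map fun ρ => z + starRingEnd ℂ ρ).prod
    set s := (R.map fun ρ => -ρ.re).sum
    obtain ⟨σ, hσ⟩ : ∃ σ : ℝ, σ = -ρ.re := ⟨_, rfl⟩
    have hσ0 : 0 < σ := by linarith
    obtain ⟨x, hx⟩ : ∃ x : ℝ, x = z.re := ⟨_, rfl⟩
    have hab : ‖z - ρ‖ ^ 2 - ‖z + starRingEnd ℂ ρ‖ ^ 2 = 4 * x * σ := by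
      rw [← Complex.normSq_eq_norm_sq, ← Complex.normSq_eq_norm_sq, Complex.normSq_apply,
        Complex.normSq_apply]
      simp only [Complex.sub_re, Complex.sub_im, Complex.add_re, Complex.add_im, Complex.conj_re,
        Complex.conj_im, hσ, hx]
      ring
    have hsub : (z - ρ) * P - (z + starRingEnd ℂ ρ) * Q =
        (2 * σ : ℝ) * P + (z + starRingEnd ℂ ρ) * (P - Q) := by
      have : ((2 * σ : ℝ) : ℂ) = -(ρ + starRingEnd ℂ ρ) := by
        rw [Complex.add_conj, hσ]; push_cast; ring
      rw [this]; ring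
    have hle : ‖z + starRingEnd ℂ ρ‖ ≤ ‖z - ρ‖ := by
      have : 0 ≤ 4 * x * σ := by rw [hx]; positivity
      exact abs_le_of_sq_le_sq' (by linarith) (norm_nonneg _) |>.2
    have hs0 : 0 ≤ s := by
      rcases h2 with rfl | h2
      · simp [s]
      · exact h2.le
    refine ⟨?_, Or.inr (by linarith), ?_⟩
    · rw [norm_mul, norm_mul]
      exact mul_le_mul hle h1 (norm_nonneg _) (norm_nonneg _)
    · have htri := norm_add_le ((2 * σ : ℝ) * P) ((z + starRingEnd ℂ ρ) * (P - Q))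
      rw [← hsub, norm_mul, norm_mul (z + _), Complex.norm_real, Real.norm_of_nonneg (by positivity)]
        at htri
      rw [norm_mul, norm_mul, mul_pow, mul_pow, ← hσ, ← hx]
      rw [← hx] at h3 hz
      set α := ‖z - ρ‖
      set β := ‖z + starRingEnd ℂ ρ‖
      set p := ‖P‖
      set q := ‖Q‖
      set d := ‖P - Q‖ with hd
      have hβ : 0 ≤ β := norm_nonneg _
      have hp : 0 ≤ p := norm_nonneg _
      have hd0 : 0 ≤ d := norm_nonneg _
      have hsq : ‖(z - ρ) * P - (z + starRingEnd ℂ ρ) * Q‖ ^ 2 ≤ (2 * σ * p + β * d) ^ 2 :=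
        pow_le_pow_left₀ (norm_nonneg _) htri 2
      refine (mul_le_mul_of_nonneg_left hsq hz).trans ?_
      have hα : α ^ 2 = β ^ 2 + 4 * x * σ := by linarith
      rw [hα]
      rcases h2 with rfl | hs
      · have : d = 0 := by simp [hd, P, Q]
        have hs : s = 0 := by simp [s]
        have hq : q = p := by simp [p, q, P, Q]
        rw [this, hs, hq]
        apply le_of_eq
        ring
      -- This is the weighted Cauchy-Schwarz inequality `(2σp + βd)² ≤ (σ + s)((2σp)²/σ + (βd)²/s)`,
      -- cleared of denominators; `h5` is its defect. The empty product is treated apart because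
      -- there `s = 0`.
      · have h4 : x * (β * d) ^ 2 ≤ s * (β ^ 2 * (p ^ 2 - q ^ 2)) := by
          have := mul_le_mul_of_nonneg_left h3 (sq_nonneg β)
          nlinarith
        have h5 : 0 ≤ x * (s * (2 * σ * p) - σ * (β * d)) ^ 2 := mul_nonneg hz (sq_nonneg _)
        have h6 : 0 ≤ σ * (σ + s) * (s * (β ^ 2 * (p ^ 2 - q ^ 2)) - x * (β * d) ^ 2) :=
          mul_nonneg (by positivity) (by linarith)
        have h7 : 0 ≤ (σ * s) * ((σ + s) * ((β ^ 2 + 4 * x * σ) * p ^ 2 - β ^ 2 * q ^ 2) -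
            x * (2 * σ * p + β * d) ^ 2) := by
          nlinarith
        have h8 : 0 < σ * s := by positivity
        linarith [nonneg_of_mul_nonneg_right h7 h8]

/-- The reflection of `q`, evaluated at a complex number. -/
noncomputable def reflectEval (q : ℝ[X]) (z : ℂ) : ℂ := (-1) ^ q.natDegree * aeval (-z) q

theorem aeval_eq_prod (q : ℝ[X]) (z : ℂ) :
    aeval z q = q.leadingCoeff * ((q.map (algebraMap ℝ ℂ)).roots.map fun ρ => z - ρ).prod := by
  have h := (IsAlgClosed.splits (q.map (algebraMap ℝ ℂ))).eq_prod_roots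
  rw [← eval_map_algebraMap]
  conv_lhs => rw [h]
  rw [eval_mul, eval_C, eval_multiset_prod, Multiset.map_map, leadingCoeff_map]
  simp

/-- As `q` is real, `q(-z)` is the conjugate of `q` at `-conj z`; the sign in `reflectEval` absorbs
the sign of each linear factor. -/
theorem reflectEval_eq_prod (q : ℝ[X]) (z : ℂ) :
    reflectEval q z = q.leadingCoeff *
      ((q.map (algebraMap ℝ ℂ)).roots.map fun ρ => z + starRingEnd ℂ ρ).prod := by
  have hcard : (q.map (algebraMap ℝ ℂ)).roots.card = q.natDegree := by
    rw [← (IsAlgClosed.splits (q.map (algebraMap ℝ ℂ))).natDegree_eq_card_roots, natDegree_map]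
  have h : aeval (-z) q = starRingEnd ℂ (aeval (-starRingEnd ℂ z) q) := by
    rw [← map_neg, aeval_conj, Complex.conj_conj]
  rw [reflectEval, h, aeval_eq_prod, map_mul, Complex.conj_ofReal, map_multiset_prod,
    Multiset.map_map, ← hcard, mul_left_comm]
  congr 1
  induction (q.map (algebraMap ℝ ℂ)).roots using Multiset.induction_on with
  | empty => simp
  | cons ρ R ih =>
    simp only [Multiset.map_cons, Multiset.prod_cons, Multiset.card_cons, Function.comp_apply,
      map_sub, map_neg, Complex.conj_conj, pow_succ] at ih ⊢
    rw [← ih]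
    ring

/-- The Blaschke bound with its constant read off from the coefficients: by Vieta, the sum of `-Re
ρ` over the roots is `a_1 / a_0`. -/
theorem stable_julia {q : ℝ[X]} (hq : IsStable q) (hq0 : q ≠ 0) {z : ℂ} (hz : 0 ≤ z.re) :
    ‖reflectEval q z‖ ≤ ‖aeval z q‖ ∧
      (q.natDegree = 0 ∨ 0 < descCoeff q 1 / q.leadingCoeff) ∧
      z.re * ‖aeval z q - reflectEval q z‖ ^ 2 ≤
        descCoeff q 1 / q.leadingCoeff * (‖aeval z q‖ ^ 2 - ‖reflectEval q z‖ ^ 2) := by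
  set R := (q.map (algebraMap ℝ ℂ)).roots with hRdef
  have hqm : q.map (algebraMap ℝ ℂ) ≠ 0 := (Polynomial.map_ne_zero_iff (algebraMap ℝ ℂ).injective).2 hq0
  have hsplit := IsAlgClosed.splits (q.map (algebraMap ℝ ℂ))
  have hcard : R.card = q.natDegree := by
    rw [hRdef, ← hsplit.natDegree_eq_card_roots, natDegree_map]
  have hR : ∀ ρ ∈ R, ρ.re < 0 := by
    intro ρ hρ
    refine hq ρ ?_
    rw [← eval_map_algebraMap]
    exact (mem_roots hqm).1 hρ
  obtain ⟨h1, h2, h3⟩ := blaschke_julia R hR hz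
  have hl : q.leadingCoeff ≠ 0 := leadingCoeff_ne_zero.2 hq0
  have hs : descCoeff q 1 / q.leadingCoeff = (R.map fun ρ => -ρ.re).sum := by
    by_cases hd : q.natDegree = 0
    · have hR0 : R = 0 := Multiset.card_eq_zero.1 (hcard.trans hd)
      rw [descCoeff_of_gt (by omega), hR0]
      simp
    · have h := hsplit.nextCoeff_eq_neg_sum_roots_mul_leadingCoeff
      rw [nextCoeff_map (algebraMap ℝ ℂ).injective, leadingCoeff_map,
        nextCoeff_of_natDegree_pos (Nat.pos_of_ne_zero hd)] at h
      rw [descCoeff_of_le (by omega), div_eq_iff hl]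
      have h' := congrArg Complex.re h
      have hre : R.sum.re = (R.map Complex.re).sum := map_multiset_sum Complex.reAddGroupHom R
      have hneg : (R.map fun ρ => -ρ.re).sum = -(R.map Complex.re).sum := by
        rw [← Multiset.sum_map_neg', Multiset.map_map]; rfl
      rw [hneg, ← hre]
      simp only [Complex.coe_algebraMap, neg_mul, Complex.neg_re, Complex.ofReal_re,
        Complex.re_ofReal_mul] at h'
      rw [h']
      ring
  rw [hs, aeval_eq_prod, reflectEval_eq_prod, ← mul_sub, norm_mul, norm_mul, norm_mul, mul_pow,
    mul_pow, mul_pow, ← mul_sub]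
  refine ⟨mul_le_mul_of_nonneg_left h1 (norm_nonneg _), ?_, ?_⟩
  · refine h2.imp (fun h => ?_) id
    rw [← hcard, h, Multiset.card_zero]
  · nlinarith [mul_le_mul_of_nonneg_left h3 (sq_nonneg ‖(q.leadingCoeff : ℂ)‖)]

theorem aeval_parityPart (N : ℕ) (q : ℝ[X]) (z : ℂ) :
    aeval z (parityPart N q) = (aeval z q + (-1) ^ N * aeval (-z) q) / 2 := by
  rw [parityPart, map_mul, map_add, map_mul, aeval_C, aeval_C, aeval_comp]
  simp
  ring

theorem parityPart_routhLift (c : ℝ) (N : ℕ) (p : ℝ[X]) :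
    parityPart N (routhLift c N p) = parityPart N p := by
  ext i
  rw [coeff_parityPart, coeff_parityPart]
  split_ifs with he
  · cases i with
    | zero => exact coeff_zero_routhLift c N p
    | succ i =>
      have : ¬ Even (N + i) := by rw [Nat.even_iff] at *; omega
      rw [coeff_succ_routhLift, if_neg this]; simp
  · rfl

theorem normSq_sub_two (w : ℂ) : ‖w‖ ^ 2 - ‖w - 2‖ ^ 2 = 4 * w.re - 4 := by
  rw [← Complex.normSq_eq_norm_sq, ← Complex.normSq_eq_norm_sq, Complex.normSq_apply,
    Complex.normSq_apply]
  simp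
  ring

/-- At a zero `z` of the lift, `q(z) = -czE` and the reflection is `(cz + 2)E`. For `Re z ≥ 0` the
latter is larger in modulus unless `E = 0`, against the Blaschke bound; and `E = 0` makes `z` a zero
of `q`. -/
theorem isStable_routhLift {q : ℝ[X]} (hq : IsStable q) (hq0 : q ≠ 0) {c : ℝ} (hc : 0 < c) :
    IsStable (routhLift c q.natDegree q) := by
  intro z hz
  by_contra! hre
  obtain ⟨h1, -, -⟩ := stable_julia hq hq0 hre
  set E := aeval z (parityPart q.natDegree q) with hE
  have hE2 : aeval z q + reflectEval q z = 2 * E := by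
    rw [hE, aeval_parityPart, reflectEval]; ring
  have hz' : aeval z q = -(c * z) * E := by
    rw [routhLift, map_add, map_mul, map_mul, aeval_C, aeval_X] at hz
    rw [hE]
    linear_combination hz
  have hr : reflectEval q z = -(-(c * z) - 2) * E := by linear_combination hE2 - hz'
  have hw := normSq_sub_two (-(c * z))
  have hsq : ‖reflectEval q z‖ ^ 2 ≤ ‖aeval z q‖ ^ 2 := pow_le_pow_left₀ (norm_nonneg _) h1 2
  rw [hr, hz', norm_mul, norm_mul, norm_neg (-(c * z) - 2 : ℂ), mul_pow, mul_pow] at hsq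
  have hwre : (-(c * z) : ℂ).re = -(c * z.re) := by simp
  rw [hwre] at hw
  have hcz : 0 ≤ c * z.re := by positivity
  have hE0 : ‖E‖ ^ 2 = 0 := by nlinarith [sq_nonneg ‖E‖]
  have hE0' : E = 0 := norm_eq_zero.1 (pow_eq_zero_iff two_ne_zero |>.1 hE0)
  rw [hE0', mul_zero] at hz'
  exact absurd (hq z hz') (not_lt.2 hre)

/-- At a zero of `q`, the lift and its reflection take the values `czE` and `(cz - 2)E`. The plain
modulus bound is not enough here: the Julia inequality, with constant `1 / c`, leaves a deficit of
`(4 / c)‖E‖²` and so forces `E = 0`. -/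
theorem isStable_of_routhLift {q : ℝ[X]} (hq0 : q ≠ 0) {c : ℝ} (hc : 0 < c)
    (hq : IsStable (routhLift c q.natDegree q)) : IsStable q := by
  intro z hz
  by_contra! hre
  have hdeg := natDegree_routhLift hc.ne' hq0
  have hlead := leadingCoeff_routhLift hc.ne' hq0
  have hl : q.leadingCoeff ≠ 0 := leadingCoeff_ne_zero.2 hq0
  have hp0 : routhLift c q.natDegree q ≠ 0 := by
    rw [← leadingCoeff_ne_zero, hlead]
    exact mul_ne_zero hc.ne' hl
  obtain ⟨-, -, h3⟩ := stable_julia hq hp0 hre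
  have h1 : descCoeff (routhLift c q.natDegree q) 1 = q.leadingCoeff := by
    rw [descCoeff_routhLift hc.ne' hq0, routhSeq, descCoeff_zero]
    simp
  have hs : descCoeff (routhLift c q.natDegree q) 1 / (routhLift c q.natDegree q).leadingCoeff =
      1 / c := by
    rw [h1, hlead]; field_simp
  rw [hs] at h3
  set p := routhLift c q.natDegree q with hp
  set E := aeval z (parityPart q.natDegree q) with hE
  have hpE : aeval z p = c * z * E := by
    rw [hp, routhLift, map_add, map_mul, map_mul, aeval_C, aeval_X, hz, zero_add]
    rfl
  have hrE : reflectEval p z = (c * z - 2) * E := by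
    have h := aeval_parityPart q.natDegree p z
    rw [hp, parityPart_routhLift, ← hE, ← hp] at h
    rw [reflectEval, hdeg, pow_succ]
    linear_combination 2 * h + hpE
  have hw := normSq_sub_two (c * z)
  have hwre : (c * z : ℂ).re = c * z.re := by simp
  rw [hwre] at hw
  have hd : aeval z p - reflectEval p z = 2 * E := by rw [hpE, hrE]; ring
  rw [hd, hpE, hrE, norm_mul 2 E, norm_mul (c * z : ℂ) E, norm_mul (c * z - 2 : ℂ) E, mul_pow,
    mul_pow, mul_pow, Complex.norm_two, ← sub_mul, hw] at h3
  have h4 : c * (z.re * (2 ^ 2 * ‖E‖ ^ 2)) ≤ c * (1 / c * ((4 * (c * z.re) - 4) * ‖E‖ ^ 2)) :=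
    mul_le_mul_of_nonneg_left h3 hc.le
  rw [← mul_assoc c (1 / c), mul_one_div_cancel hc.ne', one_mul] at h4
  have hE0 : ‖E‖ ^ 2 = 0 := by nlinarith [sq_nonneg ‖E‖]
  have hE0' : E = 0 := norm_eq_zero.1 (pow_eq_zero_iff two_ne_zero |>.1 hE0)
  rw [hE0', mul_zero] at hpE
  exact absurd (hq z hpE) (not_lt.2 hre)

/-! ### Stable polynomials as iterated Routh lifts -/

/-- The polynomials obtained from positive constants by inverting Routh reductions. -/
inductive RouthChain : ℕ → ℝ[X] → Prop
  | const {a : ℝ} (ha : 0 < a) : RouthChain 0 (C a)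
  | lift {m : ℕ} {q : ℝ[X]} {c : ℝ} (hc : 0 < c) (hq : RouthChain m q) :
      RouthChain (m + 1) (routhLift c m q)

theorem RouthChain.facts {m : ℕ} {q : ℝ[X]} (h : RouthChain m q) :
    q.natDegree = m ∧ 0 < q.leadingCoeff ∧ 0 < q.coeff 0 ∧ IsStable q := by
  induction h with
  | @const a ha =>
    refine ⟨natDegree_C a, by simpa using ha, by simpa using ha, fun z hz => ?_⟩
    rw [aeval_C] at hz
    exact absurd hz (by simpa using ha.ne')
  | @lift m q c hc _ ih =>
    obtain ⟨rfl, h2, h3, h4⟩ := ih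
    have hq0 : q ≠ 0 := leadingCoeff_ne_zero.1 h2.ne'
    refine ⟨natDegree_routhLift hc.ne' hq0, ?_, ?_, isStable_routhLift h4 hq0 hc⟩
    · rw [leadingCoeff_routhLift hc.ne' hq0]; positivity
    · rwa [coeff_zero_routhLift]

theorem IsStable.routhChain {m : ℕ} : ∀ {q : ℝ[X]}, IsStable q → 0 < q.leadingCoeff →
    q.natDegree = m → RouthChain m q := by
  induction m with
  | zero =>
    intro q _ hl hd
    have h := eq_C_of_natDegree_eq_zero hd
    rw [h] at hl ⊢
    exact .const (by simpa using hl)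
  | succ m ih =>
    intro q hq hl hd
    -- Only the sign of `a_1 / a_0` is wanted, which does not involve `z`; the point `0` is an
    -- arbitrary choice.
    obtain ⟨-, h, -⟩ := stable_julia hq (leadingCoeff_ne_zero.1 hl.ne') (z := 0) (by simp)
    have h1 : 0 < descCoeff q 1 := by
      rcases h with h | h
      · omega
      · exact (div_pos_iff_of_pos_right hl).1 h
    obtain ⟨q₁, hd₁, hl₁, -, he⟩ := exists_routhLift hd h1.ne'
    have hc : 0 < q.leadingCoeff / descCoeff q 1 := by positivity
    have hl₁' : 0 < q₁.leadingCoeff := hl₁ ▸ h1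
    subst hd₁
    rw [he] at hq ⊢
    exact .lift hc (ih (isStable_of_routhLift (leadingCoeff_ne_zero.1 hl₁'.ne') hc hq) hl₁' rfl)

theorem RouthChain.ne_zero {m : ℕ} {q : ℝ[X]} (h : RouthChain m q) : q ≠ 0 :=
  leadingCoeff_ne_zero.1 h.facts.2.1.ne'

/-! ### Hurwitz minors of `q(z) g(z²)` -/

theorem natDegree_mul_comp_sq {q g : ℝ[X]} (hq : q ≠ 0) (hg : g ≠ 0) :
    (q * g.comp (X ^ 2)).natDegree = q.natDegree + 2 * g.natDegree := by
  have : g.comp (X ^ 2) ≠ 0 := by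
    rwa [← expand_eq_comp_X_pow, Ne, expand_eq_zero two_pos]
  rw [natDegree_mul hq this, natDegree_comp, natDegree_X_pow, mul_comm]

theorem leadingCoeff_mul_comp_sq (q g : ℝ[X]) :
    (q * g.comp (X ^ 2)).leadingCoeff = q.leadingCoeff * g.leadingCoeff := by
  rw [leadingCoeff_mul, leadingCoeff_comp (by simp)]
  simp

theorem descCoeff_routhLift_mul {m : ℕ} {q g : ℝ[X]} (h : RouthChain m q) (hg : g ≠ 0) {c : ℝ}
    (hc : c ≠ 0) : descCoeff (routhLift c m q * g.comp (X ^ 2)) =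
      routhSeq c (descCoeff (q * g.comp (X ^ 2))) := by
  have hd := natDegree_mul_comp_sq h.ne_zero hg
  rw [h.facts.1] at hd
  have h0 : q * g.comp (X ^ 2) ≠ 0 := by
    rw [← leadingCoeff_ne_zero, leadingCoeff_mul_comp_sq]
    exact mul_ne_zero (leadingCoeff_ne_zero.2 h.ne_zero) (leadingCoeff_ne_zero.2 hg)
  rw [← descCoeff_routhLift hc h0, hd, routhLift_mul_comp_sq]

theorem descCoeff_C_mul_comp_sq {a : ℝ} (ha : a ≠ 0) {g : ℝ[X]} (hg : g ≠ 0) (k : ℕ) :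
    descCoeff (C a * g.comp (X ^ 2)) k = if Even k then a * descCoeff g (k / 2) else 0 := by
  have hd := natDegree_mul_comp_sq (C_ne_zero.2 ha) hg
  rw [natDegree_C, zero_add] at hd
  by_cases hk : k ≤ 2 * g.natDegree
  · rw [descCoeff_of_le (by omega), hd, coeff_C_mul, ← expand_eq_comp_X_pow, coeff_expand two_pos,
      descCoeff_of_le (by omega)]
    by_cases he : Even k
    · obtain ⟨t, rfl⟩ := he
      have h1 : 2 ∣ 2 * g.natDegree - (t + t) := by omega
      have h2 : (2 * g.natDegree - (t + t)) / 2 = g.natDegree - (t + t) / 2 := by omega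
      rw [if_pos h1, if_pos ⟨t, rfl⟩, h2]
    · have h1 : ¬ 2 ∣ 2 * g.natDegree - k := by rw [Nat.even_iff] at he; omega
      rw [if_neg h1, if_neg he, mul_zero]
  · rw [descCoeff_of_gt (by omega)]
    split_ifs with he
    · rw [descCoeff_of_gt (by rw [Nat.even_iff] at he; omega), mul_zero]
    · rfl

theorem seqHurwitz_C_mul_comp_sq {a : ℝ} (ha : a ≠ 0) {g : ℝ[X]} (hg : g ≠ 0) (i j : ℕ) :
    seqHurwitz (descCoeff (C a * g.comp (X ^ 2))) i j =
      if Odd i then a * seqToeplitz (descCoeff g) (i / 2) j else 0 := by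
  simp only [seqHurwitz, seqToeplitz, Matrix.of_apply, descCoeff_C_mul_comp_sq ha hg]
  by_cases hi : Odd i
  · obtain ⟨u, rfl⟩ := hi
    have h1 : 2 * u + 1 ≤ 2 * j + 1 ↔ u ≤ j := by omega
    have h2 : (2 * u + 1) / 2 = u := by omega
    have h3 : 2 * j + 1 - (2 * u + 1) = 2 * (j - u) := by omega
    have h4 : 2 * (j - u) / 2 = j - u := by omega
    simp [h1, h2, h3, h4]
  · rw [if_neg hi]
    have : i ≤ 2 * j + 1 → ¬ Even (2 * j + 1 - i) := by
      intro h
      rw [Nat.even_iff]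
      rw [Nat.odd_iff] at hi
      omega
    split_ifs with h1 h2
    · exact absurd h2 (this h1)
    · rfl
    · rfl

/-- The minors of the infinite Hurwitz matrix of `q(z) g(z ^ 2)` in the first `N` rows are
nonnegative. -/
theorem RouthChain.minor_nonneg {m : ℕ} {q : ℝ[X]} (h : RouthChain m q) {g : ℝ[X]} (hg : g ≠ 0)
    {r : ℕ} (hPF : IsPF r g) : ∀ N, N + m ≤ 2 * r + 1 → ∀ (k : ℕ) (I J : Fin k → ℕ),
      StrictMono I → StrictMono J → (∀ s, I s < N) →
      0 ≤ ((seqHurwitz (descCoeff (q * g.comp (X ^ 2)))).submatrix I J).det := by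
  induction h with
  | @const a ha =>
    intro N hN k I J hI hJ hIN
    by_cases hodd : ∀ s, Odd (I s)
    · have hu : StrictMono fun s => I s / 2 := by
        intro s t hst
        have h1 := hI hst
        have h2 := Nat.odd_iff.1 (hodd s)
        have h3 := Nat.odd_iff.1 (hodd t)
        dsimp only
        omega
      -- There are at most `r` odd indices below `N ≤ 2 * r + 1`, so a minor using only odd rows has
      -- order at most `r`.
      have hur : ∀ s, I s / 2 < r := by
        intro s
        have h1 := hIN s
        have h2 := Nat.odd_iff.1 (hodd s)
        omega
      have hkr : k ≤ r := by
        have := Fintype.card_le_of_injective (fun s : Fin k => (⟨I s / 2, hur s⟩ : Fin r))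
          fun s t hst => hu.injective (by simpa using hst)
        simpa using this
      have e : (seqHurwitz (descCoeff (C a * g.comp (X ^ 2)))).submatrix I J =
          a • (toeplitzMatrix g).submatrix (fun s => I s / 2) J := by
        ext s t
        rw [Matrix.submatrix_apply, seqHurwitz_C_mul_comp_sq ha.ne' hg, if_pos (hodd s)]
        rfl
      rw [e, Matrix.det_smul]
      exact mul_nonneg (pow_nonneg ha.le _) (hPF k hkr _ _ hu hJ)
    · push Not at hodd
      obtain ⟨s, hs⟩ := hodd
      refine (Matrix.det_eq_zero_of_row_eq_zero s fun j => ?_).ge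
      rw [Matrix.submatrix_apply, seqHurwitz_C_mul_comp_sq ha.ne' hg, if_neg hs]
  | @lift m q c hc hq ih =>
    intro N hN k I J hI hJ hIN
    set b := descCoeff (q * g.comp (X ^ 2)) with hb
    have e : (seqHurwitz (descCoeff (routhLift c m q * g.comp (X ^ 2)))).submatrix I J =
        Matrix.of fun s => (fun t => seqHurwitz b (I s + 1) (J t)) +
          (if Odd (I s) then c else 0) • fun t => seqHurwitz b (I s) (J t) := by
      ext s t
      rw [Matrix.submatrix_apply, descCoeff_routhLift_mul hq hg hc.ne', seqHurwitz_routhSeq]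
      rfl
    rw [e]
    refine det_bidiagonal_rows_nonneg (fun i t => seqHurwitz b i (J t))
      (c := fun i => if Odd i then c else 0) (fun i => ?_) hI fun I' hI' hle => ?_
    · split_ifs
      · exact hc.le
      · exact le_rfl
    -- A lift reaches one row further down while `m` drops by one, so `N + m` is preserved.
    · exact ih (N + 1) (by omega) k I' J hI' hJ fun s => by
        have := hle s
        have := hIN s
        omega

/-- Each lift raises the order of the principal minor by one and multiplies it by a positive leading
coefficient. At the constant stage the minors are `Δ_0 = 1` and `Δ_1 = 0`. -/
theorem RouthChain.hurwitzMinor {m : ℕ} {q : ℝ[X]} (h : RouthChain m q) {g : ℝ[X]}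
    (hg : 0 < g.leadingCoeff) : 0 < hurwitzMinor m (q * g.comp (X ^ 2)) ∧
      FiniteHurwitz.hurwitzMinor (m + 1) (q * g.comp (X ^ 2)) = 0 := by
  have hg0 : g ≠ 0 := leadingCoeff_ne_zero.1 hg.ne'
  simp only [FiniteHurwitz.hurwitzMinor, hurwitzMatrix_eq]
  induction h with
  | @const a ha =>
    refine ⟨by simp, Matrix.det_eq_zero_of_row_eq_zero 0 fun j => ?_⟩
    rw [Matrix.submatrix_apply, seqHurwitz_C_mul_comp_sq ha.ne' hg0]
    simp
  | @lift m q c hc hq ih =>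
    rw [descCoeff_routhLift_mul hq hg0 hc.ne', det_seqHurwitz_routhSeq_principal,
      det_seqHurwitz_routhSeq_principal, ih.2, descCoeff_zero, leadingCoeff_mul_comp_sq, mul_zero]
    exact ⟨mul_pos (mul_pos hq.facts.2.1 hg) ih.1, rfl⟩

/-! ### From Hurwitz minors to Toeplitz minors of `g` -/

theorem seqToeplitz_one (i j : ℕ) :
    seqToeplitz (descCoeff 1) i j = if i = j then 1 else 0 := by
  rcases lt_trichotomy i j with h | h | h
  · rw [seqToeplitz_of_le _ h.le, descCoeff_of_gt (by simp; omega), if_neg h.ne]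
  · rw [seqToeplitz_of_le _ h.le, h, Nat.sub_self, descCoeff_zero, if_pos rfl, leadingCoeff_one]
  · rw [seqToeplitz_of_lt _ h, if_neg h.ne']

/-- The Hurwitz matrix of `q(z) g(z ^ 2)` is the product of the Hurwitz matrix of `q` and the
Toeplitz matrix of `g`. -/
theorem RouthChain.seqHurwitz_mul {m : ℕ} {q : ℝ[X]} (h : RouthChain m q) {g : ℝ[X]}
    (hg : g ≠ 0) : ∀ (N i j : ℕ), j < N → seqHurwitz (descCoeff (q * g.comp (X ^ 2))) i j =
      ∑ k ∈ Finset.range N, seqHurwitz (descCoeff q) i k * seqToeplitz (descCoeff g) k j := by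
  induction h with
  | @const a ha =>
    intro N i j hj
    have h1 : ∀ k, seqHurwitz (descCoeff (C a)) i k =
        if Odd i then a * seqToeplitz (descCoeff 1) (i / 2) k else 0 := by
      intro k
      have := seqHurwitz_C_mul_comp_sq ha.ne' one_ne_zero i k
      rwa [one_comp, mul_one] at this
    simp only [h1, seqHurwitz_C_mul_comp_sq ha.ne' hg, seqToeplitz_one]
    by_cases hi : Odd i
    · simp only [hi, if_true, mul_ite, mul_one, mul_zero, ite_mul, zero_mul, Finset.sum_ite_eq,
        Finset.mem_range]
      split_ifs with hN
      · rfl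
      · rw [seqToeplitz_of_lt _ (by omega), mul_zero]
    · simp [hi]
  | @lift m q c hc hq ih =>
    intro N i j hj
    have hq' : descCoeff (routhLift c m q) = routhSeq c (descCoeff q) := by
      rw [← descCoeff_routhLift hc.ne' hq.ne_zero, hq.facts.1]
    simp only [descCoeff_routhLift_mul hq hg hc.ne', hq', seqHurwitz_routhSeq, ih N _ j hj,
      Finset.mul_sum, add_mul, Finset.sum_add_distrib, mul_assoc]

/-- A square submatrix of the infinite Hurwitz matrix of `q` with positive determinant. -/
theorem RouthChain.det_rows_pos {m : ℕ} {q : ℝ[X]} (h : RouthChain m q) (l : ℕ) :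
    0 < ((seqHurwitz (descCoeff q)).submatrix
      (fun s : Fin (m + l) => if (s : ℕ) < m then (s : ℕ) else 2 * s + 1 - m) Fin.val).det := by
  obtain ⟨hd, -, h0, -⟩ := h.facts
  -- The rows after the first `m` are `m + 1, m + 3, …`, chosen so that this block is triangular
  -- with diagonal entries `a_m = q(0)`.
  set D : Matrix (Fin l) (Fin l) ℝ := (seqHurwitz (descCoeff q)).submatrix
    (fun t => m + 2 * (t : ℕ) + 1) (fun t => m + (t : ℕ)) with hD
  have hDdet : D.det = q.coeff 0 ^ l := by
    rw [Matrix.det_of_isLowerTriangular]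
    · have : ∀ t, D t t = q.coeff 0 := by
        intro t
        have h1 : m + 2 * (t : ℕ) + 1 ≤ 2 * (m + t) + 1 := by omega
        have h2 : 2 * (m + (t : ℕ)) + 1 - (m + 2 * t + 1) = m := by omega
        simp only [hD, Matrix.submatrix_apply, seqHurwitz, Matrix.of_apply, if_pos h1, h2]
        rw [descCoeff_of_le hd.ge, hd, Nat.sub_self]
      simp [this]
    · intro t u htu
      have htu' : (t : ℕ) < u := htu
      have h1 : m + 2 * (t : ℕ) + 1 ≤ 2 * (m + u) + 1 := by omega
      simp only [hD, Matrix.submatrix_apply, seqHurwitz, Matrix.of_apply, if_pos h1]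
      exact descCoeff_of_gt (by omega)
  rw [← Matrix.det_submatrix_equiv_self (finSumFinEquiv (m := m) (n := l))]
  have e : ((seqHurwitz (descCoeff q)).submatrix (fun s : Fin (m + l) =>
      if (s : ℕ) < m then (s : ℕ) else 2 * s + 1 - m) Fin.val).submatrix
        (finSumFinEquiv (m := m) (n := l)) (finSumFinEquiv (m := m) (n := l)) =
      Matrix.fromBlocks ((seqHurwitz (descCoeff q)).submatrix Fin.val Fin.val) 0
        ((seqHurwitz (descCoeff q)).submatrix (fun t : Fin l => m + 2 * (t : ℕ) + 1) Fin.val) D := by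
    have h3 : ∀ t : ℕ, 2 * (m + t) + 1 - m = m + 2 * t + 1 := by intro t; omega
    ext (i | i) (j | j)
    · simp
    · have h1 : (i : ℕ) ≤ 2 * (m + (j : ℕ)) + 1 := by have := i.2; omega
      have h2 : descCoeff q (2 * (m + (j : ℕ)) + 1 - i) = 0 :=
        descCoeff_of_gt (by have := i.2; omega)
      simp [seqHurwitz, h2]
    · simp [h3]
    · simp [h3, hD]
  rw [e, Matrix.det_fromBlocks_zero₁₂, hDdet]
  refine mul_pos ?_ (pow_pos h0 l)
  have := (h.hurwitzMinor (g := 1) (by simp)).1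
  rwa [one_comp, mul_one] at this

theorem det_seqToeplitz_cons (a : ℕ → ℝ) {k : ℕ} (J : Fin k → ℕ) :
    ((seqToeplitz a).submatrix (Fin.val : Fin (k + 1) → ℕ)
        (Matrix.vecCons 0 fun s => J s + 1)).det =
      a 0 * ((seqToeplitz a).submatrix Fin.val J).det := by
  rw [Matrix.det_succ_column_zero, Fin.sum_univ_succ, Finset.sum_eq_zero]
  · have : ((seqToeplitz a).submatrix (Fin.val : Fin (k + 1) → ℕ)
        (Matrix.vecCons 0 fun s => J s + 1)).submatrix (Fin.succAbove 0) Fin.succ =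
        (seqToeplitz a).submatrix Fin.val J := by
      ext i j
      have := seqToeplitz_add a 1 i (J j)
      simpa [add_comm] using this
    rw [this]
    simp [seqToeplitz]
  · intro i _
    simp [seqToeplitz]

theorem strictMono_cons_zero {k : ℕ} {J : Fin k → ℕ} (hJ : StrictMono J) :
    StrictMono (Matrix.vecCons 0 fun s => J s + 1 : Fin (k + 1) → ℕ) := by
  intro s t hst
  induction t using Fin.cases with
  | zero => exact absurd hst (Fin.not_lt_zero s)
  | succ t =>
    induction s using Fin.cases with
    | zero => simp
    | succ s => simpa using hJ (Fin.succ_lt_succ_iff.1 hst)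

/-- Prefixing column 0 and shifting the others turns a minor of order `k` into one of order `k + 1`,
at the cost of the positive factor `a 0`. -/
theorem toeplitz_initial_nonneg_of_top {a : ℕ → ℝ} (ha : 0 < a 0) {r : ℕ}
    (htop : ∀ J : Fin r → ℕ, StrictMono J → 0 ≤ ((seqToeplitz a).submatrix Fin.val J).det) :
    ∀ k ≤ r, ∀ J : Fin k → ℕ, StrictMono J → 0 ≤ ((seqToeplitz a).submatrix Fin.val J).det := by
  intro k hk
  induction hk using Nat.decreasingInduction with
  | self => exact htop
  | of_succ k hk ih =>
    intro J hJ
    have h := ih _ (strictMono_cons_zero hJ)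
    rw [det_seqToeplitz_cons] at h
    exact nonneg_of_mul_nonneg_right h ha

theorem RouthChain.isPF {m : ℕ} {q : ℝ[X]} (h : RouthChain m q) {g : ℝ[X]}
    (hg : 0 < g.leadingCoeff)
    (hTN : TotallyNonneg (hurwitzMatrix (m + 2 * g.natDegree) (q * g.comp (X ^ 2)))) :
    IsPF (m + g.natDegree) g := by
  have hg0 : g ≠ 0 := leadingCoeff_ne_zero.1 hg.ne'
  have hd := h.facts.1
  have ha : 0 < descCoeff g 0 := by rwa [descCoeff_zero]
  obtain ⟨l, hl⟩ : ∃ l, g.natDegree = l := ⟨_, rfl⟩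
  rw [hl] at hTN ⊢
  refine timesNonneg_seqToeplitz ha (toeplitz_initial_nonneg_of_top ha ?_)
  intro J hJ
  by_cases hJn : ∀ s, J s < m + 2 * l
  · set ρ : Fin (m + l) → ℕ := fun s => if (s : ℕ) < m then (s : ℕ) else 2 * s + 1 - m with hρ
    have hρn : ∀ s, ρ s < m + 2 * l := by
      intro s
      have := s.2
      simp only [hρ]
      split_ifs <;> omega
    have hρm : StrictMono ρ := by
      intro s t hst
      have : (s : ℕ) < t := hst
      simp only [hρ]
      split_ifs <;> omega
    have hnn := hTN (m + l) (m + l) le_rfl (fun s => ⟨ρ s, hρn s⟩) (fun s => ⟨J s, hJn s⟩)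
      (fun s t hst => hρm hst) (fun s t hst => hJ hst)
    -- The selected rows lie below `m + 2 * l`, where the Hurwitz matrix of `q` vanishes from column
    -- `m + l` on. The product of infinite matrices thus truncates to square ones, and determinants
    -- simply multiply.
    have e : (hurwitzMatrix (m + 2 * l) (q * g.comp (X ^ 2))).submatrix (fun s => ⟨ρ s, hρn s⟩)
        (fun s => ⟨J s, hJn s⟩) =
        (seqHurwitz (descCoeff q)).submatrix ρ (Fin.val : Fin (m + l) → ℕ) *
          (seqToeplitz (descCoeff g)).submatrix (Fin.val : Fin (m + l) → ℕ) J := by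
      ext s t
      rw [hurwitzMatrix_eq, Matrix.submatrix_apply, Matrix.submatrix_apply, Matrix.mul_apply,
        h.seqHurwitz_mul hg0 (m + l + (J t + 1)) _ _ (by simp; omega), Finset.sum_range_add,
        Finset.sum_range]
      simp only [Matrix.submatrix_apply, add_eq_left]
      refine Finset.sum_eq_zero fun k _ => mul_eq_zero_of_left ?_ _
      have := hρn s
      simp only [seqHurwitz, Matrix.of_apply]
      split_ifs
      · exact descCoeff_of_gt (by omega)
      · rfl
    rw [e, Matrix.det_mul] at hnn
    exact nonneg_of_mul_nonneg_right hnn (h.det_rows_pos l)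
  · push Not at hJn
    obtain ⟨s, hs⟩ := hJn
    -- Columns from `m + 2 * l` on are out of reach of `H_n`, but in the first `m + l` rows they are
    -- zero.
    refine (Matrix.det_eq_zero_of_column_eq_zero s fun i => ?_).ge
    have := i.2
    rw [Matrix.submatrix_apply, seqToeplitz_of_le _ (show (i : ℕ) ≤ J s by omega)]
    exact descCoeff_of_gt (by omega)

/-! ### Extracting the factorization -/

/-- Nonnegativity of the minors in the initial rows of the Hurwitz matrix of order `n`. -/
def InitialNonneg (n : ℕ) (b : ℕ → ℝ) : Prop :=
  ∀ k ≤ n, ∀ J : Fin k → ℕ, StrictMono J → (∀ s, J s < n) →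
    0 ≤ ((seqHurwitz b).submatrix Fin.val J).det

theorem TotallyNonneg.initialNonneg {n : ℕ} {p : ℝ[X]} (h : TotallyNonneg (hurwitzMatrix n p)) :
    InitialNonneg n (descCoeff p) := fun k hk J hJ hJn =>
  h k k le_rfl (Fin.castLE hk) (fun s => ⟨J s, hJn s⟩) (Fin.strictMono_castLE hk)
    fun _ _ hst => hJ hst

theorem InitialNonneg.odd_nonneg {n : ℕ} {b : ℕ → ℝ} (h : InitialNonneg n b) {j : ℕ} (hj : j < n) :
    0 ≤ b (2 * j + 1) := by
  have := h 1 (by omega) (fun _ => j) (Subsingleton.strictMono _) fun _ => hj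
  simpa [seqHurwitz] using this

/-- With `b 1 = 0`, the minor on rows 0, 1 and columns 0, `j` is `-b 0 * b (2 * j + 1)`, so an odd
coefficient is both nonpositive and nonnegative. -/
theorem InitialNonneg.odd_eq_zero {n : ℕ} {b : ℕ → ℝ} (h : InitialNonneg n b) (h0 : 0 < b 0)
    (h1 : b 1 = 0) {j : ℕ} (hj : j < n) : b (2 * j + 1) = 0 := by
  rcases Nat.eq_zero_or_pos j with rfl | hj0
  · exact h1
  · have h2 := h 2 (by omega) ![0, j] (by
      intro s t hst
      fin_cases s <;> fin_cases t <;> simp_all) (by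
      intro s
      fin_cases s <;> simp <;> omega)
    have h3 := h.odd_nonneg hj
    rw [Matrix.det_fin_two] at h2
    simp [seqHurwitz, h1] at h2
    nlinarith

theorem InitialNonneg.of_routhSeq {n : ℕ} {c : ℝ} {b : ℕ → ℝ}
    (h : InitialNonneg (n + 1) (routhSeq c b)) (hb : 0 < b 0) : InitialNonneg n b := by
  intro k hk J hJ hJn
  have := h (k + 1) (by omega) _ (strictMono_cons_zero hJ) fun s => by
    refine Fin.cases ?_ (fun s => ?_) s
    · simp
    · simpa using hJn s
  rw [det_seqHurwitz_routhSeq_cons] at this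
  exact nonneg_of_mul_nonneg_right this hb

theorem eq_comp_sq_of_odd_eq_zero {p : ℝ[X]} (hp0 : p.coeff 0 ≠ 0)
    (h : ∀ j, descCoeff p (2 * j + 1) = 0) : p = (contract 2 p).comp (X ^ 2) := by
  -- An odd degree would make the constant term one of the vanishing odd coefficients.
  have heven : Even p.natDegree := by
    by_contra hodd
    obtain ⟨j, hj⟩ := Nat.not_even_iff_odd.1 hodd
    have := h j
    rw [descCoeff_of_le hj.ge, hj, Nat.sub_self] at this
    exact hp0 this
  rw [← expand_eq_comp_X_pow]
  ext i
  rw [coeff_expand two_pos]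
  split_ifs with hi
  · rw [coeff_contract two_ne_zero, Nat.div_mul_cancel hi]
  · by_cases hid : i ≤ p.natDegree
    · obtain ⟨t, ht⟩ := heven
      obtain ⟨j, hj⟩ : ∃ j, p.natDegree - i = 2 * j + 1 := ⟨(p.natDegree - i) / 2, by omega⟩
      have := h j
      rwa [descCoeff_of_le (by omega), ← hj, Nat.sub_sub_self hid] at this
    · exact coeff_eq_zero_of_natDegree_lt (by omega)

/-- Induction along Routh reduction: `Δ_{m+1} ≠ 0` rules out `a_1 = 0`, since then the whole first
row would vanish, while `Δ_1 = 0` stops the process at a polynomial in `z²`. -/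
theorem exists_factorization (m : ℕ) : ∀ (n : ℕ) (p : ℝ[X]), p.natDegree = n →
    0 < p.leadingCoeff → p.coeff 0 ≠ 0 → InitialNonneg n (descCoeff p) → hurwitzMinor m p ≠ 0 →
    hurwitzMinor (m + 1) p = 0 →
    ∃ q g : ℝ[X], RouthChain m q ∧ 0 < g.leadingCoeff ∧ p = q * g.comp (X ^ 2) := by
  have hodd : ∀ (n : ℕ) (p : ℝ[X]), p.natDegree = n → 0 < p.leadingCoeff →
      InitialNonneg n (descCoeff p) → descCoeff p 1 = 0 → ∀ j, descCoeff p (2 * j + 1) = 0 := by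
    intro n p hn hl hI h1 j
    by_cases hj : j < n
    · exact hI.odd_eq_zero (by rwa [descCoeff_zero]) h1 hj
    · exact descCoeff_of_gt (by omega)
  induction m with
  | zero =>
    intro n p hn hl hp0 hI _ h1
    have h1' : descCoeff p 1 = 0 := by
      simpa [hurwitzMinor, hurwitzMatrix_eq, seqHurwitz] using h1
    have he := eq_comp_sq_of_odd_eq_zero hp0 (hodd n p hn hl hI h1')
    have he' : p = C 1 * (contract 2 p).comp (X ^ 2) := by simpa using he
    refine ⟨C 1, contract 2 p, .const one_pos, ?_, he'⟩
    rw [he', leadingCoeff_mul_comp_sq] at hl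
    simpa using hl
  | succ m ih =>
    intro n p hn hl hp0 hI hm hm1
    have h1 : descCoeff p 1 ≠ 0 := by
      intro h1
      refine hm (Matrix.det_eq_zero_of_row_eq_zero 0 fun j => ?_)
      have := hodd n p hn hl hI h1 j
      simpa [hurwitzMatrix_eq, seqHurwitz] using this
    have hn0 : n ≠ 0 := by
      rintro rfl
      exact h1 (descCoeff_of_gt (by omega))
    obtain ⟨n, rfl⟩ := Nat.exists_eq_succ_of_ne_zero hn0
    have hpos : 0 < descCoeff p 1 := lt_of_le_of_ne (hI.odd_nonneg (Nat.succ_pos n)) (Ne.symm h1)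
    obtain ⟨p₁, hd₁, hl₁, hz₁, he⟩ := exists_routhLift hn h1
    set c := p.leadingCoeff / descCoeff p 1 with hc
    have hc0 : 0 < c := div_pos hl hpos
    have hl₁' : 0 < p₁.leadingCoeff := hl₁ ▸ hpos
    have hseq : descCoeff p = routhSeq c (descCoeff p₁) := by
      conv_lhs => rw [he, ← hd₁]
      exact descCoeff_routhLift hc0.ne' (leadingCoeff_ne_zero.1 hl₁'.ne')
    have hb : 0 < descCoeff p₁ 0 := by rwa [descCoeff_zero]
    rw [hurwitzMinor, hurwitzMatrix_eq, hseq, det_seqHurwitz_routhSeq_principal] at hm hm1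
    rw [hseq] at hI
    obtain ⟨q, g, hq, hg, hqg⟩ := ih n p₁ hd₁ hl₁' (by rwa [hz₁]) (hI.of_routhSeq hb)
      (right_ne_zero_of_mul hm) ((mul_eq_zero.1 hm1).resolve_left hb.ne')
    refine ⟨routhLift c m q, g, .lift hc0 hq, hg, ?_⟩
    have hdeg := natDegree_mul_comp_sq hq.ne_zero (leadingCoeff_ne_zero.1 hg.ne')
    rw [← hqg, hd₁, hq.facts.1] at hdeg
    rw [he, hqg, hdeg, routhLift_mul_comp_sq]

/-! ### The equivalence -/

theorem RouthChain.hurwitz_of_isPF {m : ℕ} {q : ℝ[X]} (h : RouthChain m q) {g : ℝ[X]}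
    (hg : 0 < g.leadingCoeff) (hPF : IsPF (m + g.natDegree) g) :
    TotallyNonneg (hurwitzMatrix (m + 2 * g.natDegree) (q * g.comp (X ^ 2))) :=
  fun _ k _ rows cols hr hc =>
    h.minor_nonneg (leadingCoeff_ne_zero.1 hg.ne') hPF (m + 2 * g.natDegree) (by omega) k
      (fun s => rows s) (fun s => cols s) (fun _ _ hst => hr hst) (fun _ _ hst => hc hst)
      fun s => (rows s).2

end FiniteHurwitz

theorem lemma5p6 (n m : ℕ) (p : ℝ[X]) (hdeg : p.natDegree = n)
    (hlead : 0 < p.leadingCoeff) (hp0 : p.coeff 0 ≠ 0) :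
    (FiniteHurwitz.TotallyNonneg (FiniteHurwitz.hurwitzMatrix n p) ∧
        FiniteHurwitz.hurwitzMinor m p ≠ 0 ∧ FiniteHurwitz.hurwitzMinor (m + 1) p = 0) ↔
      ∃ q g : ℝ[X], p = q * g.comp (X ^ 2) ∧ q.natDegree = m ∧
        FiniteHurwitz.IsStable q ∧ FiniteHurwitz.IsPF ((n + m) / 2) g := by
  open FiniteHurwitz in
  constructor
  · rintro ⟨hTN, hm, hm1⟩
    obtain ⟨q, g, hq, hg, hp⟩ := exists_factorization m n p hdeg hlead hp0 hTN.initialNonneg hm hm1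
    obtain ⟨hqd, -, -, hqs⟩ := hq.facts
    refine ⟨q, g, hp, hqd, hqs, ?_⟩
    have hn : n = m + 2 * g.natDegree := by
      rw [← hdeg, hp, natDegree_mul_comp_sq hq.ne_zero (leadingCoeff_ne_zero.1 hg.ne'), hqd]
    rw [show (n + m) / 2 = m + g.natDegree by omega]
    rw [hn, hp] at hTN
    exact hq.isPF hg hTN
  · rintro ⟨q, g, hp, hqd, hqs, hPF⟩
    have hp_ne : p ≠ 0 := leadingCoeff_ne_zero.1 hlead.ne'
    have hq0 : q ≠ 0 := by rintro rfl; simp [hp] at hp_ne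
    have hg0 : g ≠ 0 := by rintro rfl; simp [hp] at hp_ne
    have hn : n = m + 2 * g.natDegree := by
      rw [← hdeg, hp, natDegree_mul_comp_sq hq0 hg0, hqd]
    rw [show (n + m) / 2 = m + g.natDegree by omega] at hPF
    have hlead' := hlead
    rw [hp, leadingCoeff_mul_comp_sq] at hlead'
    suffices ∃ q' g' : ℝ[X], RouthChain m q' ∧ 0 < g'.leadingCoeff ∧ g'.natDegree = g.natDegree ∧
        IsPF (m + g'.natDegree) g' ∧ p = q' * g'.comp (X ^ 2) by
      obtain ⟨q', g', hq', hg', hd', hPF', hp'⟩ := this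
      have h := hq'.hurwitzMinor hg'
      rw [hp', hn, ← hd']
      exact ⟨hq'.hurwitz_of_isPF hg' hPF', h.1.ne', h.2⟩
    -- The class `PF_0` says nothing about the sign of `g`, so two negative constant factors are
    -- possible; they are replaced by `p` and `1`. Otherwise minors of order 1 give `g_0 > 0`, hence
    -- a positive leading coefficient of `q`.
    by_cases hr : m + g.natDegree = 0
    · have hpd : p.natDegree = 0 := by omega
      have hm : m = 0 := by omega
      subst hm
      have hpC := eq_C_of_natDegree_eq_zero hpd
      have hc : 0 < p.coeff 0 := by rw [hpC] at hlead; simpa using hlead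
      refine ⟨C (p.coeff 0), 1, .const hc, by simp, by simp; omega, ?_, by simpa using hpC⟩
      intro k hk rows cols _ _
      obtain rfl : k = 0 := by simpa using hk
      simp
    · have h1 := hPF 1 (by omega) (fun _ => 0) (fun _ => 0) (Subsingleton.strictMono _)
        (Subsingleton.strictMono _)
      have hg : 0 < g.leadingCoeff := by
        refine lt_of_le_of_ne ?_ (leadingCoeff_ne_zero.2 hg0).symm
        simpa [toeplitzMatrix_eq, seqToeplitz, descCoeff_zero] using h1
      exact ⟨q, g, hqs.routhChain (pos_of_mul_pos_left hlead' hg.le) hqd, hg, rfl, hPF, hp⟩
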